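/- For $1\le p\le\infty$ let $L_p$ be the space of $2\pi$-periodic real functions with norm $\|\varphi\|_p=\bigl(\int_{-\pi}^{\pi}|\varphi(t)|^p\,dt\bigr)^{1/p}$ for $p<\infty$ and $\|\varphi\|_\infty=\operatorname{ess\,sup}_t|\varphi(t)|$, and let $\|g\|_C=\max_t|g(t)|$ for continuous $2\pi$-periodic $g$. For $r>1$ and $\beta\in\mathbb R$ let $$B_{r,\beta}(t)=\sum_{k=1}^\infty k^{-r}\cos\Bigl(kt-\frac{\beta\pi}{2}\Bigr),$$ and let the Weyl–Nagy class $W^r_{\beta,p}$ consist of all functions $$f(x)=\frac{a_0}{2}+\frac1\pi\int_{-\pi}^{\pi}\varphi(x-t)\,B_{r,\beta}(t)\,dt,\qquad a_0\in\mathbb R,\quad \varphi\in L_p,\quad \|\varphi\|_p\le 1,\quad \int_{-\pi}^{\pi}\varphi(t)\,dt=0.$$ Put $\mathcal E_n(W^r_{\beta,p})_C=\sup_{f\in W^r_{\beta,p}}\|f-S_{n-1}(f)\|_C$, where $S_{n-1}(f)$ is the partial Fourier sum of $f$ of order $n-1$. **Theorem 2.** Let $1\le p\le\infty$, $\beta\in\mathbb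 R$, $r>1$, $n\in\mathbb N$ and $n+1\le r\le n^2$. If $p=1$, then $$\mathcal E_n(W^r_{\beta,1})_C=n^{-r}\Bigl(\frac{1}{\pi(1-e^{-r/n})}+O(1)\,\frac{r}{n^{2}}\,e^{-r/n}\Bigr),$$ and if $1<p\le\infty$ and $\frac1p+\frac1{p'}=1$, then $$\mathcal E_n(W^r_{\beta,p})_C=n^{-r}\Bigl(\frac{\|\cos t\|_{p'}}{\pi}\,F^{1/p'}\Bigl(\frac{p'}2,\frac{p'}2;1;e^{-2r/n}\Bigr)+O(1)\,\frac{r}{n^{2}}\,e^{-r/n}\Bigr),$$ where $F(a,b;c;z)=1+\sum_{k=1}^\infty\frac{(a)_k(b)_k}{(c)_k}\frac{z^k}{k!}$ with $(x)_k=x(x+1)\cdots(x+k-1)$ is the Gauss hypergeometric function. In both formulas $O(1)$ denotes a quantity bounded in absolute value by an absolute constant, uniformly in $n$, $r$, $\beta$ and $p$. -/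

import Mathlib

open Real MeasureTheory
open scoped ENNReal

namespace WeylNagy

/-- Lebesgue measure (not normalized) on one period. -/
noncomputable def periodMeasure : Measure ℝ := volume.restrict (Set.Ioc (-π) π)

/-- The norm of the space `L_p` of `2π`-periodic functions, `1 ≤ p ≤ ∞`: the `p`-th root of the
integral of `|g|^p` over a period, and the essential supremum of `|g|` when `p = ∞`. -/
noncomputable def normLp (p : ℝ≥0∞) (g : ℝ → ℝ) : ℝ≥0∞ := eLpNorm g p periodMeasure

/-- The unit ball `B_p^0` of the mean-zero `2π`-periodic functions in `L_p`. -/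
def unitBallZero (p : ℝ≥0∞) : Set (ℝ → ℝ) :=
  {φ | Function.Periodic φ (2 * π) ∧ MemLp φ p periodMeasure ∧ normLp p φ ≤ 1 ∧
    ∫ t in (-π)..π, φ t = 0}

/-- The Weyl–Nagy kernel `B_{r,β}(t) = ∑_{k ≥ 1} k^{-r} cos (k t - β π / 2)`; the series is
absolutely convergent for `r > 1`, the only range in which it is used. -/
noncomputable def kernel (r β t : ℝ) : ℝ :=
  ∑' k : ℕ, ((k : ℝ) + 1) ^ (-r) * cos (((k : ℝ) + 1) * t - β * π / 2)

/-- The Weyl–Nagy class `W^r_{β,p}` of the functions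
`f(x) = a₀ / 2 + (1 / π) ∫_{-π}^{π} φ(x - t) B_{r,β}(t) dt` with `a₀ ∈ ℝ` and `φ ∈ B_p^0`. -/
def weylNagyClass (r β : ℝ) (p : ℝ≥0∞) : Set (ℝ → ℝ) :=
  {f | ∃ a₀ : ℝ, ∃ φ ∈ unitBallZero p, ∀ x : ℝ,
    f x = a₀ / 2 + (1 / π) * ∫ t in (-π)..π, φ (x - t) * kernel r β t}

/-- The cosine Fourier coefficient `a_k` of `f`. -/
noncomputable def fourierCos (f : ℝ → ℝ) (k : ℕ) : ℝ :=
  (1 / π) * ∫ t in (-π)..π, f t * cos (k * t)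

/-- The sine Fourier coefficient `b_k` of `f`. -/
noncomputable def fourierSin (f : ℝ → ℝ) (k : ℕ) : ℝ :=
  (1 / π) * ∫ t in (-π)..π, f t * sin (k * t)

/-- The partial Fourier sum `S_m(f; x)` of order `m`. -/
noncomputable def fourierSum (m : ℕ) (f : ℝ → ℝ) (x : ℝ) : ℝ :=
  fourierCos f 0 / 2 +
    ∑ k ∈ Finset.Icc 1 m, (fourierCos f k * cos (k * x) + fourierSin f k * sin (k * x))

/-- The uniform norm of a function, with values in `[0, ∞]`. -/
noncomputable def normC (g : ℝ → ℝ) : ℝ≥0∞ := ⨆ x : ℝ, ENNReal.ofReal |g x|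

/-- The quantity `𝓔_n(𝔑)_C = sup_{f ∈ 𝔑} ‖f - S_{n-1}(f)‖_C`, for `n ≥ 1`, with values in
`[0, ∞]`. -/
noncomputable def fourierDeviation (n : ℕ) (N : Set (ℝ → ℝ)) : ℝ≥0∞ :=
  ⨆ f ∈ N, normC (fun x => f x - fourierSum (n - 1) f x)

end WeylNagy

/-! Subtracting the partial Fourier sum removes the first n - 1 harmonics of the kernel, so the
deviation is (1/π) times the convolution of φ with the tail kernel (`sub_fourierSum_eq`). Multiplied
by n^r, the tail has coefficients (1 + k/n)^(-r) on the cosines cos((n + k)t - βπ/2). With q =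
e^(-r/n), these coefficients differ from q^k in ℓ¹ by O(q r/n²) (`exists_tsum_coeff_sub_pow_le`), so
the tail may be replaced uniformly by the Poisson-type kernel Re(e^(i(nt - γ)) g(t)), where g(t) =
1/(1 - q e^(it)) and γ = βπ/2.

By duality the supremum is close to 1/π times the L_{p'} norm of that kernel. The upper bound is
Hölder's inequality. For the lower bound, extremal functions need not have mean zero. The kernel
nearly changes sign under translation by π/n, so they can be antisymmetrized at a cost O(q/n)
(`ofReal_le_fourierDeviation_of_approx`).

The kernel equals |g(t)| cos(nt + arg g(t) - γ), a slow amplitude times a fast oscillation.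
Translation by s changes γ by ns, up to the Lipschitz error of g, so the norm depends on γ only up
to O(q/n). It is therefore close to its p'-mean over all phases, in which modulus and argument
decouple: ∫|g|^p' times ∫|cos|^p'. Parseval's identity for (1 - q e^(it))^(-p'/2) turns the first
factor into 2πF. For p = 1 the dual norm is the maximum, which is 1/(1 - q) up to O(q/n). All
constants are uniform in p because (2π)^(1/p) ≤ 2π. -/

namespace WeylNagy

/-! ### Comparison of (1 + k/n)^(-r) with the powers of e^(-r/n) -/

theorem sub_log_one_add_le {x : ℝ} (hx : 0 ≤ x) : x - log (1 + x) ≤ x ^ 2 / 2 := by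
  have h := Real.le_log_one_add_of_nonneg hx
  have h2 : x - 2 * x / (x + 2) ≤ x ^ 2 / 2 := by
    rw [sub_le_iff_le_add, ← sub_le_iff_le_add', le_div_iff₀ (by positivity)]
    nlinarith [mul_nonneg hx (mul_nonneg hx hx)]
  linarith

theorem one_add_rpow_neg_eq {x r : ℝ} (hx : 0 ≤ x) :
    (1 + x) ^ (-r) = exp (-(r * log (1 + x))) := by
  rw [rpow_def_of_pos (by linarith)]; ring_nf

theorem exp_le_one_add_rpow_neg {x r : ℝ} (hx : 0 ≤ x) (hr : 0 ≤ r) :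
    exp (-(r * x)) ≤ (1 + x) ^ (-r) := by
  rw [one_add_rpow_neg_eq hx]
  have := Real.log_le_sub_one_of_pos (show 0 < 1 + x by linarith)
  exact exp_le_exp.2 (neg_le_neg (mul_le_mul_of_nonneg_left (by linarith) hr))

/-- The ratio of the two terms is exp(-r(x - log(1 + x))), and 1 - e^(-u) ≤ u. Factoring out the
larger term leaves a polynomially decaying weight that can absorb the growth of x². -/
theorem one_add_rpow_neg_sub_exp_le {x r : ℝ} (hx : 0 ≤ x) (hr : 0 ≤ r) :
    (1 + x) ^ (-r) - exp (-(r * x)) ≤ (1 + x) ^ (-r) * (r * x ^ 2 / 2) := by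
  rw [one_add_rpow_neg_eq hx]
  have h1 : exp (-(r * x)) = exp (-(r * log (1 + x))) * exp (-(r * (x - log (1 + x)))) := by
    rw [← exp_add]; ring_nf
  have h2 := Real.add_one_le_exp (-(r * (x - log (1 + x))))
  have h3 : r * (x - log (1 + x)) ≤ r * x ^ 2 / 2 := by
    have := mul_le_mul_of_nonneg_left (sub_log_one_add_le hx) hr
    linarith
  rw [h1, ← mul_one_sub]
  exact mul_le_mul_of_nonneg_left (by linarith) (exp_pos _).le

/-- The coefficients decay polynomially relative to the first one. -/
theorem one_add_div_rpow_neg_le {n r m : ℝ} (j : ℕ) (hn : 0 < n) (hm : 0 < m) (hmr : m ≤ r)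
    (hr : n + 1 ≤ r) :
    (1 + ((j : ℝ) + 1) / n) ^ (-r) ≤ (1 + 1 / n) ^ (-r) * (1 + (j : ℝ) / m) ^ (-m) := by
  have hj : (0 : ℝ) ≤ j := Nat.cast_nonneg j
  have h1 : 1 + ((j : ℝ) + 1) / n = (1 + 1 / n) * (1 + j / (n + 1)) := by
    field_simp; ring
  rw [h1, mul_rpow (by positivity) (by positivity)]
  refine mul_le_mul_of_nonneg_left ?_ (by positivity)
  -- Bernoulli's inequality with exponent r/m ≥ 1; then r ≥ n + 1 gives (r/m) · j/(n + 1) ≥ j/m.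
  have h2 : 1 + (j : ℝ) / m ≤ (1 + j / (n + 1)) ^ (r / m) := by
    have h := one_add_mul_self_le_rpow_one_add (s := (j : ℝ) / (n + 1)) (p := r / m)
      (by have : 0 ≤ (j : ℝ) / (n + 1) := by positivity
          linarith) ((one_le_div hm).2 hmr)
    refine le_trans ?_ h
    have h3 : r / m * (j / (n + 1)) = (r / (n + 1)) * (j / m) := by ring
    have h4 : 1 ≤ r / (n + 1) := (one_le_div (by linarith)).2 hr
    rw [h3]
    nlinarith [show 0 ≤ (j : ℝ) / m by positivity]
  have h5 : (1 + (j : ℝ) / (n + 1)) ^ (-r) = ((1 + j / (n + 1)) ^ (r / m)) ^ (-m) := by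
    rw [← rpow_mul (by positivity)]; congr 1; field_simp
  rw [h5]
  exact rpow_le_rpow_of_nonpos (by positivity) h2 (by linarith)

theorem summable_quarter : Summable fun j : ℕ => (1 + (j : ℝ) / 4) ^ (-2 : ℝ) := by
  have h : Summable fun j : ℕ => (16 : ℝ) * (1 / ((j + 1 : ℕ) : ℝ) ^ 2) :=
    ((summable_nat_add_iff 1).2 (Real.summable_one_div_nat_pow.2 one_lt_two)).mul_left 16
  refine Summable.of_nonneg_of_le (fun j => by positivity) (fun j => ?_) h
  have hj : (0 : ℝ) ≤ j := Nat.cast_nonneg j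
  rw [rpow_neg (by positivity), show (2 : ℝ) = ((2 : ℕ) : ℝ) by norm_num, rpow_natCast,
    ← one_div, mul_one_div, div_le_div_iff₀ (by positivity) (by positivity)]
  push_cast
  nlinarith

/-- With x = (j + 1)/n, the relative error r x²/2 supplies r/n², the leading coefficient supplies
e^(-r/n), and decay of order 4 outweighs the factor (j + 1)², leaving a summable weight independent
of n and r. -/
theorem coeff_sub_pow_le {n : ℕ} {r : ℝ} (hr : (n : ℝ) + 1 ≤ r) (hr2 : r ≤ (n : ℝ) ^ 2) (j : ℕ) :
    |(1 + ((j + 1 : ℕ) : ℝ) / n) ^ (-r) - exp (-r / n) ^ (j + 1)| ≤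
      16 * (r / (n : ℝ) ^ 2 * exp (-r / n)) * (1 + (j : ℝ) / 4) ^ (-2 : ℝ) := by
  -- The two bounds on r are incompatible for n = 0 and n = 1.
  have hn2 : 2 ≤ n := by
    by_contra! h
    interval_cases n <;> norm_num at hr hr2 <;> linarith
  have hn2' : (2 : ℝ) ≤ n := by exact_mod_cast hn2
  have hn : (0 : ℝ) < n := by linarith
  have hj : (0 : ℝ) ≤ j := Nat.cast_nonneg j
  have hr0 : 0 < r := by linarith
  set q := exp (-r / n) with hq
  have hq0 : 0 < q := exp_pos _
  have hx : (0 : ℝ) ≤ ((j + 1 : ℕ) : ℝ) / n := by positivity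
  have hpow : q ^ (j + 1) = exp (-(r * (((j + 1 : ℕ) : ℝ) / n))) := by
    rw [hq, ← exp_nat_mul]; congr 1; ring
  rw [hpow, abs_of_nonneg (sub_nonneg.2 (exp_le_one_add_rpow_neg hx hr0.le))]
  -- The quotient by q is at most e^(r/(2n²)), which is at most √e < 2 because r ≤ n².
  have ha1 : (1 + 1 / (n : ℝ)) ^ (-r) ≤ 2 * q := by
    have h1 := one_add_rpow_neg_eq (x := 1 / (n : ℝ)) (r := r) (by positivity)
    have h2 := sub_log_one_add_le (x := 1 / (n : ℝ)) (by positivity)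
    have h3 : -(r * log (1 + 1 / (n : ℝ))) ≤ -r / n + 1 / 2 := by
      have h4 := mul_le_mul_of_nonneg_left h2 hr0.le
      have h5 : r * ((1 / (n : ℝ)) ^ 2 / 2) ≤ 1 / 2 := by
        rw [one_div_pow, div_div, mul_one_div, div_le_div_iff₀ (by positivity) (by norm_num)]
        linarith
      have h6 : r * (1 / (n : ℝ)) = r / n := by ring
      rw [neg_div]
      linarith
    have h7 : exp (1 / 2 : ℝ) ≤ 2 := by
      have h8 : exp (1 / 2 : ℝ) ^ 2 = exp 1 := by rw [← exp_nat_mul]; norm_num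
      nlinarith [Real.exp_one_lt_d9, exp_pos (1 / 2 : ℝ)]
    calc (1 + 1 / (n : ℝ)) ^ (-r) ≤ exp (-r / n + 1 / 2) := by rw [h1]; exact exp_le_exp.2 h3
      _ = exp (1 / 2) * q := by rw [exp_add, mul_comm]
      _ ≤ 2 * q := mul_le_mul_of_nonneg_right h7 hq0.le
  have hkey : ∀ m : ℝ, 0 < m → m ≤ r →
      (1 + ((j + 1 : ℕ) : ℝ) / n) ^ (-r) ≤ 2 * q * (1 + (j : ℝ) / m) ^ (-m) := by
    intro m hm hmr
    have := one_add_div_rpow_neg_le j hn hm hmr hr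
    push_cast
    exact this.trans (mul_le_mul_of_nonneg_right ha1 (by positivity))
  -- For n = 2 only r ≥ 3 is known, so decay of order 4 is not available; but then r/n² ≥ 3/4, and
  -- bounding the difference by its larger term suffices. For n ≥ 3, r ≥ 4.
  rcases eq_or_lt_of_le hn2 with h2 | h3
  · have h := hkey 3 (by norm_num) (by linarith)
    have hb : (1 + (j : ℝ) / 3) ^ (-3 : ℝ) ≤ (1 + (j : ℝ) / 4) ^ (-2 : ℝ) :=
      (rpow_le_rpow_of_exponent_le (by linarith [show 0 ≤ (j : ℝ) / 3 by positivity])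
        (by norm_num : (-3 : ℝ) ≤ -2)).trans
        (rpow_le_rpow_of_nonpos (by positivity) (by linarith) (by norm_num))
    have hc : (3 : ℝ) / 4 ≤ r / (n : ℝ) ^ 2 := by
      rw [← h2]; push_cast; rw [← h2] at hr; push_cast at hr; linarith
    have hd : 0 ≤ (1 + (j : ℝ) / 4) ^ (-2 : ℝ) := by positivity
    calc _ ≤ (1 + ((j + 1 : ℕ) : ℝ) / n) ^ (-r) := sub_le_self _ (exp_pos _).le
      _ ≤ 2 * q * (1 + (j : ℝ) / 4) ^ (-2 : ℝ) :=
          h.trans (mul_le_mul_of_nonneg_left hb (by positivity))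
      _ ≤ _ := mul_le_mul_of_nonneg_right (by nlinarith) hd
  · have h3' : (3 : ℝ) ≤ n := by exact_mod_cast h3
    have h := hkey 4 (by norm_num) (by linarith)
    have hB : 0 < 1 + (j : ℝ) / 4 := by positivity
    have hs : (1 + (j : ℝ) / 4) ^ (-4 : ℝ) * (1 + (j : ℝ) / 4) ^ 2 = (1 + (j : ℝ) / 4) ^ (-2 : ℝ) := by
      rw [← rpow_natCast, ← rpow_add hB]; norm_num
    -- The constant 16 is chosen so that the right side is (j + 4)².
    have hk : (((j + 1 : ℕ) : ℝ)) ^ 2 ≤ 16 * (1 + (j : ℝ) / 4) ^ 2 := by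
      push_cast; nlinarith
    calc _ ≤ (1 + ((j + 1 : ℕ) : ℝ) / n) ^ (-r) * (r * (((j + 1 : ℕ) : ℝ) / n) ^ 2 / 2) :=
          one_add_rpow_neg_sub_exp_le hx hr0.le
      _ ≤ (2 * q * (1 + (j : ℝ) / 4) ^ (-4 : ℝ)) * (r * (((j + 1 : ℕ) : ℝ) / n) ^ 2 / 2) :=
          mul_le_mul_of_nonneg_right h (by positivity)
      _ = q * (r / (n : ℝ) ^ 2) * (1 + (j : ℝ) / 4) ^ (-4 : ℝ) * (((j + 1 : ℕ) : ℝ)) ^ 2 := by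
          rw [div_pow]; ring
      _ ≤ q * (r / (n : ℝ) ^ 2) * (1 + (j : ℝ) / 4) ^ (-4 : ℝ) * (16 * (1 + (j : ℝ) / 4) ^ 2) :=
          mul_le_mul_of_nonneg_left hk (by positivity)
      _ = _ := by rw [← hs]; ring

/-- The coefficients `(1 + k / n)^{-r}` are close in `ℓ¹` to the powers of `e^{-r / n}`. -/
theorem exists_tsum_coeff_sub_pow_le : ∃ C : ℝ, 0 ≤ C ∧ ∀ (n : ℕ) (r : ℝ), (n : ℝ) + 1 ≤ r →
    r ≤ (n : ℝ) ^ 2 →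
    (Summable fun k : ℕ => |(1 + (k : ℝ) / n) ^ (-r) - exp (-r / n) ^ k|) ∧
    ∑' k : ℕ, |(1 + (k : ℝ) / n) ^ (-r) - exp (-r / n) ^ k| ≤
      C * (r / (n : ℝ) ^ 2 * exp (-r / n)) := by
  refine ⟨16 * ∑' j : ℕ, (1 + (j : ℝ) / 4) ^ (-2 : ℝ),
    mul_nonneg (by norm_num) (tsum_nonneg fun j => by positivity), fun n r hr hr2 => ?_⟩
  have hle := coeff_sub_pow_le hr hr2
  have hs := summable_quarter.mul_left (16 * (r / (n : ℝ) ^ 2 * exp (-r / n)))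
  have h1 : Summable fun j : ℕ => |(1 + ((j + 1 : ℕ) : ℝ) / n) ^ (-r) - exp (-r / n) ^ (j + 1)| :=
    Summable.of_nonneg_of_le (fun _ => abs_nonneg _) hle hs
  have h2 := (summable_nat_add_iff (f := fun k : ℕ =>
    |(1 + (k : ℝ) / n) ^ (-r) - exp (-r / n) ^ k|) 1).1 h1
  refine ⟨h2, ?_⟩
  rw [h2.tsum_eq_zero_add]
  have h0 : |(1 + ((0 : ℕ) : ℝ) / n) ^ (-r) - exp (-r / n) ^ 0| = 0 := by simp
  rw [h0, zero_add]
  refine (h1.tsum_le_tsum hle hs).trans (le_of_eq ?_)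
  rw [tsum_mul_left]; ring

/-! ### Translation invariance, norms and Hölder's inequality on a period -/

instance : IsFiniteMeasure periodMeasure := by
  unfold periodMeasure; infer_instance

theorem periodMeasure_univ : periodMeasure Set.univ = ENNReal.ofReal (2 * π) := by
  rw [periodMeasure, Measure.restrict_apply_univ, Real.volume_Ioc]; ring_nf

theorem intervalIntegral_eq_integral_periodMeasure {E : Type*} [NormedAddCommGroup E]
    [NormedSpace ℝ E] (g : ℝ → E) :
    ∫ t in (-π)..π, g t = ∫ t, g t ∂periodMeasure := by
  rw [intervalIntegral.integral_of_le (by linarith [pi_pos]), periodMeasure]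

theorem integrable_of_continuous {E : Type*} [NormedAddCommGroup E] {g : ℝ → E}
    (hg : Continuous g) : Integrable g periodMeasure := by
  have := (hg.intervalIntegrable (μ := volume) (-π) π).1
  exact this

/-- Reduction modulo `2π` to the fundamental period. -/
noncomputable def reduce (t : ℝ) : ℝ := toIocMod Real.two_pi_pos (-π) t

theorem apply_reduce {α : Type*} {g : ℝ → α} (hg : Function.Periodic g (2 * π)) (t : ℝ) :
    g (reduce t) = g t := by
  rw [reduce, toIocMod, hg.sub_zsmul_eq]

instance : Fact (0 < 2 * π) := ⟨Real.two_pi_pos⟩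

theorem measurePreserving_mk_periodMeasure :
    MeasurePreserving (fun t : ℝ => (t : AddCircle (2 * π))) periodMeasure volume := by
  have := AddCircle.measurePreserving_mk (2 * π) (-π)
  rwa [show -π + 2 * π = π by ring] at this

theorem measurePreserving_lift_periodMeasure :
    MeasurePreserving (fun x : AddCircle (2 * π) =>
      ((AddCircle.equivIoc (2 * π) (-π) x : Set.Ioc (-π) (-π + 2 * π)) : ℝ))
      volume periodMeasure := by
  have h := AddCircle.measurePreserving_equivIoc (T := 2 * π) (a := -π)
  have h2 := measurePreserving_subtype_coe (μa := (volume : Measure ℝ))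
    (measurableSet_Ioc (a := -π) (b := -π + 2 * π))
  have h3 := h2.comp h
  have h4 : periodMeasure = volume.restrict (Set.Ioc (-π) (-π + 2 * π)) := by
    rw [periodMeasure, show -π + 2 * π = π by ring]
  rw [h4]
  exact h3

/-- Translation does not preserve the fundamental interval, but followed by reduction it is a
rotation of the circle. Periodic functions do not see the reduction, so their norms are translation
invariant. -/
theorem measurePreserving_reduce_add (s : ℝ) :
    MeasurePreserving (fun t => reduce (t + s)) periodMeasure periodMeasure :=
  measurePreserving_lift_periodMeasure.comp
    ((measurePreserving_add_right volume (s : AddCircle (2 * π))).comp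
      measurePreserving_mk_periodMeasure)

theorem measurePreserving_reduce_sub (x : ℝ) :
    MeasurePreserving (fun t => reduce (x - t)) periodMeasure periodMeasure :=
  measurePreserving_lift_periodMeasure.comp
    ((Measure.measurePreserving_sub_left volume (x : AddCircle (2 * π))).comp
      measurePreserving_mk_periodMeasure)

section Periodic

variable {g : ℝ → ℝ} {p : ℝ≥0∞}

theorem normLp_comp_add (hg : Function.Periodic g (2 * π))
    (hm : AEStronglyMeasurable g periodMeasure) (s : ℝ) :
    normLp p (fun t => g (t + s)) = normLp p g := by
  rw [normLp, normLp, ← eLpNorm_comp_measurePreserving hm (measurePreserving_reduce_add s)]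
  simp only [Function.comp_def, apply_reduce hg]

theorem normLp_comp_sub (hg : Function.Periodic g (2 * π))
    (hm : AEStronglyMeasurable g periodMeasure) (x : ℝ) :
    normLp p (fun t => g (x - t)) = normLp p g := by
  rw [normLp, normLp, ← eLpNorm_comp_measurePreserving hm (measurePreserving_reduce_sub x)]
  simp only [Function.comp_def, apply_reduce hg]

theorem memLp_comp_add (hg : Function.Periodic g (2 * π)) (hm : MemLp g p periodMeasure) (s : ℝ) :
    MemLp (fun t => g (t + s)) p periodMeasure := by
  have := hm.comp_measurePreserving (measurePreserving_reduce_add s)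
  simpa only [Function.comp_def, apply_reduce hg] using this

theorem memLp_comp_sub (hg : Function.Periodic g (2 * π)) (hm : MemLp g p periodMeasure) (x : ℝ) :
    MemLp (fun t => g (x - t)) p periodMeasure := by
  have := hm.comp_measurePreserving (measurePreserving_reduce_sub x)
  simpa only [Function.comp_def, apply_reduce hg] using this

theorem integral_comp_sub (hg : Function.Periodic g (2 * π)) (x : ℝ) :
    ∫ t, g (x - t) ∂periodMeasure = ∫ t, g t ∂periodMeasure := by
  rw [← intervalIntegral_eq_integral_periodMeasure, ← intervalIntegral_eq_integral_periodMeasure,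
    intervalIntegral.integral_comp_sub_left]
  have := hg.intervalIntegral_add_eq (x - π) (-π)
  rw [show x - π + 2 * π = x - -π by ring, show -π + 2 * π = π by ring] at this
  exact this

theorem integral_comp_add (hg : Function.Periodic g (2 * π)) (s : ℝ) :
    ∫ t, g (t + s) ∂periodMeasure = ∫ t, g t ∂periodMeasure := by
  rw [← intervalIntegral_eq_integral_periodMeasure, ← intervalIntegral_eq_integral_periodMeasure,
    intervalIntegral.integral_comp_add_right]
  have := hg.intervalIntegral_add_eq (-π + s) (-π)
  rw [show -π + s + 2 * π = π + s by ring, show -π + 2 * π = π by ring] at this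
  exact this

/-- A bounded function has `L_p` norm at most `2π` times the bound. -/
theorem normLp_le_of_bound (hp : 1 ≤ p) {M : ℝ} (h : ∀ t, |g t| ≤ M) :
    normLp p g ≤ ENNReal.ofReal (2 * π * M) := by
  have h0 : 0 ≤ M := (abs_nonneg _).trans (h 0)
  have h2 : (1 : ℝ≥0∞) ≤ ENNReal.ofReal (2 * π) := by
    rw [← ENNReal.ofReal_one]
    exact ENNReal.ofReal_le_ofReal (by linarith [pi_gt_three])
  refine (eLpNorm_le_of_ae_bound (C := M) (ae_of_all _ h)).trans ?_
  rw [periodMeasure_univ, ENNReal.ofReal_mul (p := 2 * π) (by positivity)]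
  refine mul_le_mul' ?_ le_rfl
  calc ENNReal.ofReal (2 * π) ^ p.toReal⁻¹ ≤ ENNReal.ofReal (2 * π) ^ (1 : ℝ) := by
        refine ENNReal.rpow_le_rpow_of_exponent_le h2 ?_
        rcases eq_or_ne p ⊤ with rfl | hpt
        · simp
        · refine inv_le_one_of_one_le₀ ?_
          rwa [← ENNReal.ofReal_le_iff_le_toReal hpt, ENNReal.ofReal_one]
    _ = _ := ENNReal.rpow_one _

/-- On a period, the `L_1` norm is at most `2π` times the `L_p` norm. -/
theorem normLp_one_le (hp : 1 ≤ p) (hm : AEStronglyMeasurable g periodMeasure) :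
    normLp 1 g ≤ normLp p g * ENNReal.ofReal (2 * π) := by
  have h2 : (1 : ℝ≥0∞) ≤ ENNReal.ofReal (2 * π) := by
    rw [← ENNReal.ofReal_one]
    exact ENNReal.ofReal_le_ofReal (by linarith [pi_gt_three])
  have h := eLpNorm_le_eLpNorm_mul_rpow_measure_univ (μ := periodMeasure) hp hm
  refine h.trans ?_
  rw [periodMeasure_univ]
  unfold normLp
  gcongr
  calc _ ≤ ENNReal.ofReal (2 * π) ^ (1 : ℝ) := by
        refine ENNReal.rpow_le_rpow_of_exponent_le h2 ?_
        have : 0 ≤ 1 / p.toReal := by positivity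
        simp only [ENNReal.toReal_one]; linarith
    _ = _ := ENNReal.rpow_one _

theorem integral_abs_le (hp : 1 ≤ p) (hm : MemLp g p periodMeasure) (h : normLp p g ≤ 1) :
    ∫ t, |g t| ∂periodMeasure ≤ 2 * π := by
  have h1 := normLp_one_le hp hm.1
  have h2 : normLp 1 g ≤ ENNReal.ofReal (2 * π) :=
    h1.trans ((mul_le_mul_left h _).trans (one_mul _).le)
  rw [normLp, eLpNorm_one_eq_lintegral_enorm] at h2
  have h3 := integral_norm_eq_lintegral_enorm hm.1
  simp only [Real.norm_eq_abs] at h3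
  rw [h3]
  exact ENNReal.toReal_le_of_le_ofReal (by positivity) h2

/-- Hölder's inequality on the period. -/
theorem abs_integral_mul_le {k : ℝ → ℝ} {p' : ℝ≥0∞} [ENNReal.HolderConjugate p p']
    (hg : AEStronglyMeasurable g periodMeasure) (hk : AEStronglyMeasurable k periodMeasure) :
    ENNReal.ofReal |∫ t, g t * k t ∂periodMeasure| ≤ normLp p g * normLp p' k := by
  have h := eLpNorm_smul_le_mul_eLpNorm (μ := periodMeasure) (p := p) (q := p') (r := 1) hk hg
  refine le_trans ?_ h
  rw [eLpNorm_one_eq_lintegral_enorm, ← Real.norm_eq_abs, ofReal_norm]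
  simpa only [Pi.smul_apply', smul_eq_mul] using
    enorm_integral_le_lintegral_enorm (μ := periodMeasure) (fun t => g t * k t)

end Periodic

/-! ### Fourier coefficients of absolutely convergent trigonometric series -/

/-- The free phase covers sines as well, through c = -π/2, so one orthogonality relation serves both
families of coefficients. -/
theorem integral_cos_int_mul_add (m : ℤ) (c : ℝ) :
    ∫ t, cos (m * t + c) ∂periodMeasure = if m = 0 then 2 * π * cos c else 0 := by
  rw [← intervalIntegral_eq_integral_periodMeasure]
  split_ifs with h
  · subst h
    simp only [Int.cast_zero, zero_mul, zero_add, intervalIntegral.integral_const, smul_eq_mul]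
    ring
  · have hm : (m : ℝ) ≠ 0 := Int.cast_ne_zero.2 h
    rw [intervalIntegral.integral_comp_mul_add _ hm, integral_cos]
    have h1 : (m : ℝ) * π + c = (m * -π + c) + m * (2 * π) := by ring
    rw [h1, Real.sin_add_int_mul_two_pi, sub_self, smul_zero]

theorem integral_cos_mul_cos (j k : ℕ) (c θ : ℝ) :
    ∫ t, cos (j * t - θ) * cos (((k : ℝ) + 1) * t - c) ∂periodMeasure =
      if j = k + 1 then π * cos (θ - c) else 0 := by
  have h : ∀ t : ℝ, cos (j * t - θ) * cos (((k : ℝ) + 1) * t - c) =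
      (1 / 2) * cos (((j + (k + 1) : ℤ) : ℝ) * t + (-θ - c)) +
        (1 / 2) * cos (((j - (k + 1) : ℤ) : ℝ) * t + (c - θ)) := by
    intro t
    have e1 : ((j + (k + 1) : ℤ) : ℝ) * t + (-θ - c) =
        (j * t - θ) + (((k : ℝ) + 1) * t - c) := by push_cast; ring
    have e2 : ((j - (k + 1) : ℤ) : ℝ) * t + (c - θ) =
        (j * t - θ) - (((k : ℝ) + 1) * t - c) := by push_cast; ring
    rw [e1, e2, cos_add (j * t - θ), cos_sub (j * t - θ) (((k : ℝ) + 1) * t - c)]; ring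
  simp_rw [h]
  rw [integral_add (integrable_of_continuous (by fun_prop))
    (integrable_of_continuous (by fun_prop)), integral_const_mul, integral_const_mul,
    integral_cos_int_mul_add, integral_cos_int_mul_add, if_neg (by omega), mul_zero, zero_add]
  by_cases hj : j = k + 1
  · rw [if_pos (by omega), if_pos hj, ← cos_neg, neg_sub]; ring
  · rw [if_neg (by omega), if_neg hj, mul_zero]

theorem integrable_mul_of_bound {φ w : ℝ → ℝ} (hφ : Integrable φ periodMeasure)
    (hw : Continuous w) {b : ℝ} (hb : ∀ t, |w t| ≤ b) :
    Integrable (fun t => φ t * w t) periodMeasure :=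
  hφ.mul_bdd hw.aestronglyMeasurable (ae_of_all _ hb)

theorem hasSum_integral_mul_tsum {φ : ℝ → ℝ} (hφ : Integrable φ periodMeasure)
    {w : ℕ → ℝ → ℝ} (hw : ∀ k, Continuous (w k)) {b : ℕ → ℝ} (hb : Summable b)
    (hwb : ∀ k t, |w k t| ≤ b k) :
    HasSum (fun k => ∫ t, φ t * w k t ∂periodMeasure)
      (∫ t, φ t * ∑' k, w k t ∂periodMeasure) := by
  have h1 : ∀ k, Integrable (fun t => φ t * w k t) periodMeasure :=
    fun k => integrable_mul_of_bound hφ (hw k) (hwb k)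
  have h2 := hasSum_integral_of_summable_integral_norm h1 (by
    refine Summable.of_nonneg_of_le (fun k => integral_nonneg fun t => norm_nonneg _)
      (fun k => ?_) (hb.mul_left (∫ t, ‖φ t‖ ∂periodMeasure))
    rw [← integral_mul_const]
    refine integral_mono (h1 k).norm (hφ.norm.mul_const _) fun t => ?_
    simp only [norm_mul]
    exact mul_le_mul_of_nonneg_left (hwb k t) (norm_nonneg _))
  simpa only [tsum_mul_left] using h2

/-- The terms of a trigonometric series without constant term. -/
noncomputable def trigTerm (c d : ℕ → ℝ) (k : ℕ) (x : ℝ) : ℝ :=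
  c k * cos (((k : ℝ) + 1) * x) + d k * sin (((k : ℝ) + 1) * x)

section TrigSeries

variable {c d b : ℕ → ℝ} {a : ℝ} {f : ℝ → ℝ}

theorem continuous_trigTerm (k : ℕ) : Continuous (trigTerm c d k) := by
  unfold trigTerm; fun_prop

theorem abs_trigTerm_le (hc : ∀ k, |c k| ≤ b k) (hd : ∀ k, |d k| ≤ b k) (k : ℕ) (x : ℝ) :
    |trigTerm c d k x| ≤ 2 * b k := by
  have h1 := abs_cos_le_one (((k : ℝ) + 1) * x)
  have h2 := abs_sin_le_one (((k : ℝ) + 1) * x)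
  have h3 := hc k
  have h4 := hd k
  calc _ ≤ |c k| * |cos (((k : ℝ) + 1) * x)| + |d k| * |sin (((k : ℝ) + 1) * x)| := by
        rw [← abs_mul, ← abs_mul]; exact abs_add_le _ _
    _ ≤ |c k| * 1 + |d k| * 1 := by gcongr
    _ ≤ _ := by linarith

theorem integral_cos_mul_trigTerm (j k : ℕ) (θ : ℝ) :
    ∫ x, cos (j * x - θ) * trigTerm c d k x ∂periodMeasure =
      if j = k + 1 then π * (c k * cos θ + d k * sin θ) else 0 := by
  have h : ∀ x, cos (j * x - θ) * trigTerm c d k x =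
      c k * (cos (j * x - θ) * cos (((k : ℝ) + 1) * x - 0)) +
        d k * (cos (j * x - θ) * cos (((k : ℝ) + 1) * x - π / 2)) := by
    intro x
    rw [trigTerm, sub_zero, cos_sub_pi_div_two]; ring
  simp_rw [h]
  rw [integral_add (integrable_of_continuous (by fun_prop))
    (integrable_of_continuous (by fun_prop)), integral_const_mul, integral_const_mul,
    integral_cos_mul_cos, integral_cos_mul_cos]
  split_ifs with hj
  · rw [sub_zero, cos_sub_pi_div_two]; ring
  · simp

/-- Termwise integration leaves at most one harmonic. The phase θ = 0 extracts its cosine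
coefficient and θ = π/2 its sine coefficient. -/
theorem integral_mul_cos_of_trigSeries (hb : Summable b) (hc : ∀ k, |c k| ≤ b k)
    (hd : ∀ k, |d k| ≤ b k) (hf : ∀ x, f x = a / 2 + ∑' k, trigTerm c d k x) (j : ℕ) (θ : ℝ) :
    ∫ x, f x * cos (j * x - θ) ∂periodMeasure =
      a / 2 * (∫ x, cos (j * x - θ) ∂periodMeasure) +
        ∑' k, if j = k + 1 then π * (c k * cos θ + d k * sin θ) else 0 := by
  have hcos : Continuous fun x : ℝ => cos (j * x - θ) := by fun_prop
  have h1 := hasSum_integral_mul_tsum (integrable_of_continuous hcos)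
    (continuous_trigTerm (c := c) (d := d)) (hb.mul_left 2) (abs_trigTerm_le hc hd)
  have hcont : Continuous fun x => ∑' k, trigTerm c d k x :=
    continuous_tsum continuous_trigTerm (hb.mul_left 2) (abs_trigTerm_le hc hd)
  simp_rw [integral_cos_mul_trigTerm] at h1
  rw [h1.tsum_eq, ← integral_const_mul, ← integral_add (integrable_of_continuous (by fun_prop))
    (integrable_of_continuous (by fun_prop))]
  congr 1 with x
  rw [hf x]; ring

theorem fourierCos_zero_of_trigSeries (hb : Summable b) (hc : ∀ k, |c k| ≤ b k)
    (hd : ∀ k, |d k| ≤ b k) (hf : ∀ x, f x = a / 2 + ∑' k, trigTerm c d k x) :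
    fourierCos f 0 = a := by
  have h := integral_mul_cos_of_trigSeries hb hc hd hf 0 0
  have h2 := integral_cos_int_mul_add 0 0
  rw [fourierCos, intervalIntegral_eq_integral_periodMeasure]
  simp at h h2 ⊢
  rw [h, h2]
  field_simp

theorem fourierCos_succ_of_trigSeries (hb : Summable b) (hc : ∀ k, |c k| ≤ b k)
    (hd : ∀ k, |d k| ≤ b k) (hf : ∀ x, f x = a / 2 + ∑' k, trigTerm c d k x) (j : ℕ) :
    fourierCos f (j + 1) = c j := by
  have h := integral_mul_cos_of_trigSeries hb hc hd hf (j + 1) 0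
  have h2 := integral_cos_int_mul_add (j + 1) 0
  rw [if_neg (by omega)] at h2
  rw [fourierCos, intervalIntegral_eq_integral_periodMeasure]
  rw [tsum_eq_single j (fun k hk => if_neg (by omega)), if_pos rfl] at h
  simp only [sub_zero, cos_zero, sin_zero, mul_one, mul_zero, add_zero] at h
  push_cast at h h2 ⊢
  simp only [add_zero] at h2
  rw [h, h2]
  field_simp; ring

theorem fourierSin_succ_of_trigSeries (hb : Summable b) (hc : ∀ k, |c k| ≤ b k)
    (hd : ∀ k, |d k| ≤ b k) (hf : ∀ x, f x = a / 2 + ∑' k, trigTerm c d k x) (j : ℕ) :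
    fourierSin f (j + 1) = d j := by
  have h := integral_mul_cos_of_trigSeries hb hc hd hf (j + 1) (π / 2)
  have h2 := integral_cos_int_mul_add (j + 1) (-(π / 2))
  rw [if_neg (by omega)] at h2
  rw [fourierSin, intervalIntegral_eq_integral_periodMeasure]
  rw [tsum_eq_single j (fun k hk => if_neg (by omega)), if_pos rfl] at h
  simp only [← sub_eq_add_neg, cos_sub_pi_div_two, cos_pi_div_two, sin_pi_div_two, mul_one,
    mul_zero, zero_add] at h h2
  push_cast at h h2 ⊢
  rw [h, h2]
  field_simp; ring

/-- Such a series is its own Fourier series. The term of index k has frequency k + 1, so the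
remainder starts at index m. -/
theorem sub_fourierSum_of_trigSeries (hb : Summable b) (hc : ∀ k, |c k| ≤ b k)
    (hd : ∀ k, |d k| ≤ b k) (hf : ∀ x, f x = a / 2 + ∑' k, trigTerm c d k x) (m : ℕ) (x : ℝ) :
    f x - fourierSum m f x = ∑' k, trigTerm c d (k + m) x := by
  have hs : Summable fun k => trigTerm c d k x :=
    Summable.of_norm_bounded (hb.mul_left 2) fun k => abs_trigTerm_le hc hd k x
  have h1 : fourierSum m f x = a / 2 + ∑ k ∈ Finset.range m, trigTerm c d k x := by
    rw [fourierSum, fourierCos_zero_of_trigSeries hb hc hd hf]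
    congr 1
    rw [Finset.range_eq_Ico, Finset.sum_Ico_eq_sum_range, ← Finset.Ico_succ_right_eq_Icc,
      Finset.sum_Ico_eq_sum_range]
    refine Finset.sum_congr (by simp) fun k _ => ?_
    rw [add_comm 1 k, zero_add, fourierCos_succ_of_trigSeries hb hc hd hf,
      fourierSin_succ_of_trigSeries hb hc hd hf, trigTerm]
    push_cast; rfl
  rw [h1, hf x, ← hs.sum_add_tsum_nat_add m]
  ring

end TrigSeries

/-! ### The deviation as a convolution with the tail kernel -/

/-- The terms of the Weyl–Nagy kernel. -/
noncomputable def kernelTerm (r β : ℝ) (k : ℕ) (t : ℝ) : ℝ :=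
  ((k : ℝ) + 1) ^ (-r) * cos (((k : ℝ) + 1) * t - β * π / 2)

/-- The Weyl–Nagy kernel without its first `m` harmonics. -/
noncomputable def tailKernel (r β : ℝ) (m : ℕ) (t : ℝ) : ℝ := ∑' k, kernelTerm r β (k + m) t

section Kernel

variable {r β : ℝ}

theorem continuous_kernelTerm (k : ℕ) : Continuous (kernelTerm r β k) := by
  unfold kernelTerm; fun_prop

theorem abs_kernelTerm_le (k : ℕ) (t : ℝ) : |kernelTerm r β k t| ≤ ((k : ℝ) + 1) ^ (-r) := by
  have h : (0 : ℝ) ≤ ((k : ℝ) + 1) ^ (-r) := by positivity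
  rw [kernelTerm, abs_mul, abs_of_nonneg h]
  exact mul_le_of_le_one_right h (abs_cos_le_one _)

theorem summable_add_one_rpow_neg (hr : 1 < r) : Summable fun k : ℕ => ((k : ℝ) + 1) ^ (-r) := by
  have := (summable_nat_add_iff 1).2 (Real.summable_nat_rpow.2 (neg_lt_neg hr))
  simpa using this

theorem continuous_tailKernel (hr : 1 < r) (m : ℕ) : Continuous (tailKernel r β m) :=
  continuous_tsum (fun k => continuous_kernelTerm (k + m))
    ((summable_nat_add_iff m).2 (summable_add_one_rpow_neg hr)) fun _ t => abs_kernelTerm_le _ t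

/-- After the substitution s = x - t the variable x sits inside the cosine, and the addition formula
separates it from s. -/
theorem integral_comp_sub_mul_kernelTerm {φ : ℝ → ℝ} (hφ : Function.Periodic φ (2 * π))
    (hint : Integrable φ periodMeasure) (k : ℕ) (x : ℝ) :
    ∫ t, φ (x - t) * kernelTerm r β k t ∂periodMeasure =
      trigTerm (fun k => ∫ s, φ s * (((k : ℝ) + 1) ^ (-r) *
          cos (((k : ℝ) + 1) * s + β * π / 2)) ∂periodMeasure)
        (fun k => ∫ s, φ s * (((k : ℝ) + 1) ^ (-r) *
          sin (((k : ℝ) + 1) * s + β * π / 2)) ∂periodMeasure) k x := by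
  have hper : Function.Periodic (fun s => φ s * kernelTerm r β k (x - s)) (2 * π) := by
    intro s
    have h1 : ((k : ℝ) + 1) * (x - (s + 2 * π)) - β * π / 2 =
        (((k : ℝ) + 1) * (x - s) - β * π / 2) - ((k + 1 : ℕ) : ℝ) * (2 * π) := by push_cast; ring
    simp only [kernelTerm, hφ s, h1, cos_sub_nat_mul_two_pi]
  have h := integral_comp_sub hper x
  simp only [sub_sub_cancel] at h
  rw [h, trigTerm, ← integral_mul_const, ← integral_mul_const, ← integral_add]
  · congr 1 with s
    have h1 : ((k : ℝ) + 1) * (x - s) - β * π / 2 =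
        ((k : ℝ) + 1) * x - (((k : ℝ) + 1) * s + β * π / 2) := by ring
    rw [kernelTerm, h1, cos_sub]; ring
  · refine (integrable_mul_of_bound (b := ((k : ℝ) + 1) ^ (-r)) hint (by fun_prop)
      fun t => ?_).mul_const _
    rw [abs_mul, abs_of_nonneg (by positivity)]
    exact mul_le_of_le_one_right (by positivity) (abs_cos_le_one _)
  · refine (integrable_mul_of_bound (b := ((k : ℝ) + 1) ^ (-r)) hint (by fun_prop)
      fun t => ?_).mul_const _
    rw [abs_mul, abs_of_nonneg (by positivity)]
    exact mul_le_of_le_one_right (by positivity) (abs_sin_le_one _)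

theorem abs_integral_mul_rpow_le {φ u : ℝ → ℝ} (hint : Integrable φ periodMeasure)
    (hu : ∀ s, |u s| ≤ 1) (k : ℕ) :
    |∫ s, φ s * (((k : ℝ) + 1) ^ (-r) * u s) ∂periodMeasure| ≤
      (∫ s, |φ s| ∂periodMeasure) * ((k : ℝ) + 1) ^ (-r) := by
  rw [← integral_mul_const, ← Real.norm_eq_abs]
  refine norm_integral_le_of_norm_le (hint.abs.mul_const _) (ae_of_all _ fun s => ?_)
  have h : (0 : ℝ) ≤ ((k : ℝ) + 1) ^ (-r) := by positivity
  rw [Real.norm_eq_abs, abs_mul, abs_mul, abs_of_nonneg h]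
  exact mul_le_mul_of_nonneg_left (mul_le_of_le_one_right h (hu s)) (abs_nonneg _)

/-- The deviation of a function of the class from its partial Fourier sum is the convolution with
the tail of the kernel. -/
theorem sub_fourierSum_eq (hr : 1 < r) {φ f : ℝ → ℝ} {a : ℝ} (hφ : Function.Periodic φ (2 * π))
    (hint : Integrable φ periodMeasure)
    (hf : ∀ x, f x = a / 2 + (1 / π) * ∫ t in (-π)..π, φ (x - t) * kernel r β t)
    (m : ℕ) (x : ℝ) :
    f x - fourierSum m f x = (1 / π) * ∫ t, φ (x - t) * tailKernel r β m t ∂periodMeasure := by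
  set c : ℕ → ℝ := fun k => ∫ s, φ s * (((k : ℝ) + 1) ^ (-r) *
          cos (((k : ℝ) + 1) * s + β * π / 2)) ∂periodMeasure with hc
  set d : ℕ → ℝ := fun k => ∫ s, φ s * (((k : ℝ) + 1) ^ (-r) *
          sin (((k : ℝ) + 1) * s + β * π / 2)) ∂periodMeasure with hd
  have hint' : ∀ x, Integrable (fun t => φ (x - t)) periodMeasure := fun x =>
    memLp_one_iff_integrable.1 (memLp_comp_sub hφ (memLp_one_iff_integrable.2 hint) x)
  have hsum := summable_add_one_rpow_neg hr
  -- The case m = 0 is the full kernel, so this identity yields both the series of f and its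
  -- remainder.
  have htail : ∀ m x, ∫ t, φ (x - t) * tailKernel r β m t ∂periodMeasure =
      ∑' k, trigTerm c d (k + m) x := by
    intro m x
    have h := hasSum_integral_mul_tsum (hint' x) (fun k => continuous_kernelTerm (k + m))
      ((summable_nat_add_iff m).2 hsum) (fun k t => abs_kernelTerm_le (r := r) (β := β) _ t)
    rw [tsum_congr fun k => (integral_comp_sub_mul_kernelTerm (r := r) (β := β) hφ hint (k + m)
      x).symm, h.tsum_eq]
    rfl
  have hscale : ∀ k x, trigTerm (fun k => 1 / π * c k) (fun k => 1 / π * d k) k x =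
      1 / π * trigTerm c d k x := by
    intro k x; simp only [trigTerm]; ring
  have hI : 0 ≤ ∫ s, |φ s| ∂periodMeasure := integral_nonneg fun _ => abs_nonneg _
  have hpi : (0 : ℝ) < 1 / π := by positivity
  have hbound : ∀ {e : ℝ} {k : ℕ}, |e| ≤ (∫ s, |φ s| ∂periodMeasure) * ((k : ℝ) + 1) ^ (-r) →
      |1 / π * e| ≤ 1 / π * (∫ s, |φ s| ∂periodMeasure) * ((k : ℝ) + 1) ^ (-r) := by
    intro e k h
    rw [abs_mul, abs_of_pos hpi, mul_assoc]
    exact mul_le_mul_of_nonneg_left h hpi.le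
  rw [sub_fourierSum_of_trigSeries (c := fun k => 1 / π * c k) (d := fun k => 1 / π * d k) (a := a)
    (hsum.mul_left (1 / π * ∫ s, |φ s| ∂periodMeasure))
    (fun k => hbound (abs_integral_mul_rpow_le hint (fun s => abs_cos_le_one _) k))
    (fun k => hbound (abs_integral_mul_rpow_le hint (fun s => abs_sin_le_one _) k)) _ m x]
  · simp_rw [hscale, tsum_mul_left, htail]
  · intro x
    have h0 := htail 0 x
    simp only [add_zero] at h0
    simp_rw [hf x, hscale, tsum_mul_left, intervalIntegral_eq_integral_periodMeasure, ← h0]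
    rfl

end Kernel

/-! ### The Poisson-type kernel -/

/-- The function `1 / (1 - q e^{it})`. -/
noncomputable def geomFun (q t : ℝ) : ℂ := (1 - q * Complex.exp (t * Complex.I))⁻¹

/-- The Poisson-type kernel `∑ q^k cos ((n + k) t - γ)` in closed form. -/
noncomputable def poisson (q : ℝ) (n : ℕ) (γ t : ℝ) : ℝ :=
  (Complex.exp (((n * t - γ : ℝ) : ℂ) * Complex.I) * geomFun q t).re

section Poisson

variable {q : ℝ} {n : ℕ}

theorem one_sub_le_norm (hq : 0 ≤ q) (t : ℝ) :
    1 - q ≤ ‖1 - (q : ℂ) * Complex.exp (t * Complex.I)‖ := by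
  have h := norm_sub_norm_le (1 : ℂ) ((q : ℂ) * Complex.exp (t * Complex.I))
  rw [norm_one, norm_mul, Complex.norm_exp_ofReal_mul_I, mul_one, Complex.norm_real,
    Real.norm_eq_abs, abs_of_nonneg hq] at h
  exact h

theorem one_sub_mul_exp_ne_zero (hq : 0 ≤ q) (hq1 : q < 1) (t : ℝ) :
    1 - (q : ℂ) * Complex.exp (t * Complex.I) ≠ 0 := by
  rw [← norm_pos_iff]
  linarith [one_sub_le_norm hq t]

theorem continuous_geomFun (hq : 0 ≤ q) (hq1 : q < 1) : Continuous (geomFun q) := by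
  unfold geomFun
  exact Continuous.inv₀ (by fun_prop) (one_sub_mul_exp_ne_zero hq hq1)

theorem continuous_poisson_uncurry (hq : 0 ≤ q) (hq1 : q < 1) :
    Continuous fun x : ℝ × ℝ => poisson q n x.1 x.2 := by
  unfold poisson
  have := (continuous_geomFun hq hq1).comp (continuous_snd (X := ℝ) (Y := ℝ))
  refine Complex.continuous_re.comp (Continuous.mul ?_ this)
  fun_prop

theorem continuous_poisson (hq : 0 ≤ q) (hq1 : q < 1) (γ : ℝ) : Continuous (poisson q n γ) :=
  (continuous_poisson_uncurry hq hq1).comp (Continuous.prodMk_right γ)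

theorem norm_geomFun_le (hq : 0 ≤ q) (hq1 : q < 1) (t : ℝ) : ‖geomFun q t‖ ≤ 1 / (1 - q) := by
  rw [geomFun, norm_inv, ← one_div]
  exact one_div_le_one_div_of_le (by linarith) (one_sub_le_norm hq t)

theorem abs_poisson_le (hq : 0 ≤ q) (hq1 : q < 1) (γ t : ℝ) :
    |poisson q n γ t| ≤ 1 / (1 - q) := by
  refine (Complex.abs_re_le_norm _).trans ?_
  rw [norm_mul, Complex.norm_exp_ofReal_mul_I, one_mul]
  exact norm_geomFun_le hq hq1 t

/-- In the difference of inverses the numerator is q|e^(is) - 1| ≤ q|s|. The factor q is essential: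
the final error must be proportional to e^(-r/n). -/
theorem norm_geomFun_sub_le (hq : 0 ≤ q) (hq1 : q < 1) (t s : ℝ) :
    ‖geomFun q (t + s) - geomFun q t‖ ≤ q * |s| / (1 - q) ^ 2 := by
  have h1 := one_sub_mul_exp_ne_zero hq hq1 t
  have h2 := one_sub_mul_exp_ne_zero hq hq1 (t + s)
  have hd : 0 < 1 - q := by linarith
  rw [geomFun, geomFun, inv_sub_inv h2 h1, norm_div, norm_mul]
  have h3 : 1 - (q : ℂ) * Complex.exp (t * Complex.I) -
      (1 - (q : ℂ) * Complex.exp ((t + s : ℝ) * Complex.I)) =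
      q * (Complex.exp (t * Complex.I) * (Complex.exp (Complex.I * s) - 1)) := by
    rw [mul_sub, ← Complex.exp_add]
    push_cast
    ring_nf
  rw [h3, norm_mul, norm_mul, Complex.norm_exp_ofReal_mul_I, one_mul, Complex.norm_real,
    Real.norm_eq_abs, abs_of_nonneg hq, sq]
  have h4 := Real.norm_exp_I_mul_ofReal_sub_one_le (x := s)
  rw [Real.norm_eq_abs] at h4
  exact div_le_div₀ (by positivity) (mul_le_mul_of_nonneg_left h4 hq) (by positivity)
    (mul_le_mul (one_sub_le_norm hq _) (one_sub_le_norm hq _) hd.le (norm_nonneg _))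

/-- Translation by s advances the fast factor by exactly ns, which the new phase reproduces; only
the slow factor `geomFun` contributes an error. -/
theorem abs_poisson_shift_sub_le (hq : 0 ≤ q) (hq1 : q < 1) (γ t s : ℝ) :
    |poisson q n γ (t + s) - poisson q n (γ - n * s) t| ≤ q * |s| / (1 - q) ^ 2 := by
  have h : ((n * t - (γ - n * s) : ℝ) : ℂ) = ((n * (t + s) - γ : ℝ) : ℂ) := by
    push_cast; ring
  rw [poisson, poisson, h, ← Complex.sub_re, ← mul_sub]
  refine (Complex.abs_re_le_norm _).trans ?_
  rw [norm_mul, Complex.norm_exp_ofReal_mul_I, one_mul]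
  exact norm_geomFun_sub_le hq hq1 t s

theorem geomFun_periodic : Function.Periodic (geomFun q) (2 * π) := by
  intro t
  have h : ((t + 2 * π : ℝ) : ℂ) * Complex.I = t * Complex.I + 2 * π * Complex.I := by
    push_cast; ring
  rw [geomFun, geomFun, h, Complex.exp_periodic]

/-- Polar form of the kernel. -/
theorem poisson_eq_norm_mul_cos (γ t : ℝ) :
    poisson q n γ t = ‖geomFun q t‖ * cos (n * t + Complex.arg (geomFun q t) - γ) := by
  have h : Complex.exp (((n * t - γ : ℝ) : ℂ) * Complex.I) * geomFun q t =
      ‖geomFun q t‖ * Complex.exp (((n * t + Complex.arg (geomFun q t) - γ : ℝ) : ℂ) *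
        Complex.I) := by
    conv_lhs => rw [← Complex.norm_mul_exp_arg_mul_I (geomFun q t)]
    rw [mul_left_comm, ← Complex.exp_add]
    push_cast
    ring_nf
  rw [poisson, h, Complex.re_ofReal_mul, Complex.exp_ofReal_mul_I_re]

theorem poisson_periodic (γ : ℝ) : Function.Periodic (poisson q n γ) (2 * π) := by
  intro t
  rw [poisson_eq_norm_mul_cos, poisson_eq_norm_mul_cos, geomFun_periodic t]
  have h : (n : ℝ) * (t + 2 * π) + Complex.arg (geomFun q t) - γ =
      n * t + Complex.arg (geomFun q t) - γ + n * (2 * π) := by ring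
  rw [h, cos_add_nat_mul_two_pi]

theorem poisson_sub_pi (γ t : ℝ) : poisson q n (γ - π) t = -poisson q n γ t := by
  rw [poisson_eq_norm_mul_cos, poisson_eq_norm_mul_cos]
  have h : (n : ℝ) * t + Complex.arg (geomFun q t) - (γ - π) =
      n * t + Complex.arg (geomFun q t) - γ + π := by ring
  rw [h, cos_add_pi, mul_neg]

/-- For a phase in 2πℤ the kernel takes its maximal value 1/(1 - q) at t = 0. Any other phase is
brought there by a translation of length at most π/n. -/
theorem exists_le_poisson (hq : 0 ≤ q) (hq1 : q < 1) (hn : 0 < n) (γ : ℝ) :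
    ∃ t, 1 / (1 - q) - q * (π / n) / (1 - q) ^ 2 ≤ poisson q n γ t := by
  have hn' : (0 : ℝ) < n := by exact_mod_cast hn
  obtain ⟨m, hm⟩ : ∃ m : ℤ, reduce γ = γ - m * (2 * π) :=
    ⟨toIocDiv Real.two_pi_pos (-π) γ, by rw [reduce, toIocMod, zsmul_eq_mul]⟩
  have hmem : reduce γ ∈ Set.Ioc (-π) (-π + 2 * π) := toIocMod_mem_Ioc _ _ _
  have habs : |reduce γ / n| ≤ π / n := by
    rw [abs_div, abs_of_pos hn']
    gcongr
    rw [abs_le]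
    constructor <;> linarith [hmem.1, hmem.2]
  refine ⟨0 + reduce γ / n, ?_⟩
  have h := abs_poisson_shift_sub_le (n := n) hq hq1 γ 0 (reduce γ / n)
  have h1 : γ - n * (reduce γ / n) = m * (2 * π) := by
    rw [hm]; field_simp; ring
  have h2 : poisson q n (m * (2 * π)) 0 = 1 / (1 - q) := by
    have hg : geomFun q 0 = ((1 / (1 - q) : ℝ) : ℂ) := by simp [geomFun]
    have hp : 0 ≤ 1 / (1 - q) := one_div_nonneg.2 (by linarith)
    rw [poisson_eq_norm_mul_cos, hg, Complex.arg_ofReal_of_nonneg hp, Complex.norm_real,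
      Real.norm_eq_abs, abs_of_nonneg hp, mul_zero, zero_add, zero_sub, cos_neg,
      cos_int_mul_two_pi, mul_one]
  rw [h1, h2] at h
  have h3 : q * |reduce γ / n| / (1 - q) ^ 2 ≤ q * (π / n) / (1 - q) ^ 2 := by gcongr
  linarith [(abs_le.1 h).1]

theorem hasSum_poisson (hq : 0 ≤ q) (hq1 : q < 1) (γ t : ℝ) :
    HasSum (fun k : ℕ => q ^ k * cos ((n + k) * t - γ)) (poisson q n γ t) := by
  have h := hasSum_geometric_of_norm_lt_one (ξ := (q : ℂ) * Complex.exp (t * Complex.I)) (by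
    rw [norm_mul, Complex.norm_exp_ofReal_mul_I, mul_one, Complex.norm_real, Real.norm_eq_abs,
      abs_of_nonneg hq]
    exact hq1)
  have h2 := Complex.hasSum_re (h.mul_left (Complex.exp (((n * t - γ : ℝ) : ℂ) * Complex.I)))
  refine (congrArg (fun u => HasSum u (poisson q n γ t)) (funext fun k => ?_)).mpr h2
  have e : Complex.exp (((n * t - γ : ℝ) : ℂ) * Complex.I) *
      ((q : ℂ) * Complex.exp (t * Complex.I)) ^ k =
      ((q ^ k : ℝ) : ℂ) * Complex.exp ((((n + k) * t - γ : ℝ) : ℂ) * Complex.I) := by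
    rw [mul_pow, ← Complex.exp_nat_mul, mul_left_comm, ← Complex.exp_add]
    push_cast
    ring_nf
  rw [e, Complex.re_ofReal_mul, Complex.exp_ofReal_mul_I_re]

/-- After scaling by (m + 1)^r both kernels are series in the same cosines, so their uniform
distance is at most the ℓ¹ distance of the coefficients. -/
theorem abs_tailKernel_sub_poisson_le {r β : ℝ} {m : ℕ} (hr : 1 < r) (hq : 0 ≤ q) (hq1 : q < 1)
    (hs : Summable fun k : ℕ => |(1 + (k : ℝ) / ((m + 1 : ℕ) : ℝ)) ^ (-r) - q ^ k|) (t : ℝ) :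
    |((m + 1 : ℕ) : ℝ) ^ r * tailKernel r β m t - poisson q (m + 1) (β * π / 2) t| ≤
      ∑' k : ℕ, |(1 + (k : ℝ) / ((m + 1 : ℕ) : ℝ)) ^ (-r) - q ^ k| := by
  have hm : (0 : ℝ) < ((m + 1 : ℕ) : ℝ) := by positivity
  have h1 : Summable fun k => kernelTerm r β (k + m) t :=
    Summable.of_norm_bounded ((summable_nat_add_iff m).2 (summable_add_one_rpow_neg hr))
      fun k => abs_kernelTerm_le _ t
  have h2 := (h1.hasSum.mul_left (((m + 1 : ℕ) : ℝ) ^ r)).sub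
    (hasSum_poisson (n := m + 1) hq hq1 (β * π / 2) t)
  have h3 : ∀ k : ℕ, ((m + 1 : ℕ) : ℝ) ^ r * kernelTerm r β (k + m) t -
      q ^ k * cos (((m + 1 : ℕ) + k) * t - β * π / 2) =
      ((1 + (k : ℝ) / ((m + 1 : ℕ) : ℝ)) ^ (-r) - q ^ k) *
        cos (((m + 1 : ℕ) + k) * t - β * π / 2) := by
    intro k
    have e1 : (((k + m : ℕ) : ℝ) + 1) = ((m + 1 : ℕ) : ℝ) * (1 + (k : ℝ) / ((m + 1 : ℕ) : ℝ)) := by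
      field_simp; push_cast; ring
    have e2 : (((k + m : ℕ) : ℝ) + 1) = ((m + 1 : ℕ) : ℝ) + k := by push_cast; ring
    have e3 : ((m + 1 : ℕ) : ℝ) ^ r * (((k + m : ℕ) : ℝ) + 1) ^ (-r) =
        (1 + (k : ℝ) / ((m + 1 : ℕ) : ℝ)) ^ (-r) := by
      rw [e1, mul_rpow hm.le (by positivity), ← mul_assoc, ← rpow_add hm, add_neg_cancel,
        rpow_zero, one_mul]
    rw [kernelTerm, ← mul_assoc, e3, e2, sub_mul]
  rw [funext h3] at h2
  have h4 : ∀ k : ℕ, ‖((1 + (k : ℝ) / ((m + 1 : ℕ) : ℝ)) ^ (-r) - q ^ k) *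
        cos (((m + 1 : ℕ) + k) * t - β * π / 2)‖ ≤
        |(1 + (k : ℝ) / ((m + 1 : ℕ) : ℝ)) ^ (-r) - q ^ k| := by
    intro k
    rw [norm_mul]
    exact mul_le_of_le_one_right (norm_nonneg _) (abs_cos_le_one _)
  rw [tailKernel, ← h2.tsum_eq, ← Real.norm_eq_abs]
  exact tsum_of_norm_bounded hs.hasSum h4

end Poisson

/-! ### Binomial series, Parseval's identity and the hypergeometric value -/

/-- The binomial coefficients `(a)_k / k!`. -/
noncomputable def risingCoeff (a : ℝ) (k : ℕ) : ℝ := Ring.choose (a + k - 1) k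

theorem risingCoeff_eq (a : ℝ) (k : ℕ) :
    risingCoeff a k = (ascPochhammer ℝ k).eval a / k.factorial := by
  rw [eq_div_iff (by positivity), mul_comm, risingCoeff, ← nsmul_eq_mul,
    ← Ring.descPochhammer_eq_factorial_smul_choose,
    Polynomial.descPochhammer_smeval_eq_ascPochhammer,
    Polynomial.ascPochhammer_smeval_cast, Polynomial.ascPochhammer_smeval_eq_eval]
  congr 1; ring

theorem ordinaryHypergeometric_eq_tsum_risingCoeff_sq (a z : ℝ) :
    ordinaryHypergeometric a a (1 : ℝ) z = ∑' k, risingCoeff a k ^ 2 * z ^ k := by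
  rw [ordinaryHypergeometric_eq_tsum]
  refine tsum_congr fun k => ?_
  rw [risingCoeff_eq, ascPochhammer_eval_one, smul_eq_mul]
  field_simp

theorem hasSum_risingCoeff (a : ℝ) {z : ℂ} (hz : ‖z‖ < 1) :
    HasSum (fun k => (risingCoeff a k : ℂ) * z ^ k) (1 / (1 - z) ^ (a : ℂ)) := by
  have h := (Complex.one_div_one_sub_cpow_hasFPowerSeriesOnBall_zero (a : ℂ)).hasSum
    (y := z) (by simpa [← ofReal_norm] using hz)
  simp only [FormalMultilinearSeries.ofScalars_apply_eq, zero_add, smul_eq_mul] at h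
  refine (congrArg (fun u => HasSum u (1 / (1 - z) ^ (a : ℂ))) (funext fun k => ?_)).mpr h
  rw [risingCoeff, Complex.ofReal_choose]
  push_cast
  rfl

theorem summable_abs_risingCoeff (a : ℝ) {q : ℝ} (hq : 0 ≤ q) (hq1 : q < 1) :
    Summable fun k => |risingCoeff a k| * q ^ k := by
  have h := (hasSum_risingCoeff a (z := (q : ℂ)) (by
    rwa [Complex.norm_real, Real.norm_eq_abs, abs_of_nonneg hq])).summable.norm
  refine h.congr fun k => ?_
  rw [norm_mul, norm_pow, Complex.norm_real, Complex.norm_real, Real.norm_eq_abs,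
    Real.norm_eq_abs, abs_of_nonneg hq]

theorem integral_exp_int_mul (m : ℤ) :
    ∫ t, Complex.exp ((m : ℂ) * (t * Complex.I)) ∂periodMeasure =
      if m = 0 then (2 * π : ℂ) else 0 := by
  have h1 := integral_cos_int_mul_add m 0
  have h2 := integral_cos_int_mul_add m (-(π / 2))
  simp only [← sub_eq_add_neg, cos_sub_pi_div_two, cos_neg, cos_pi_div_two, mul_zero, ite_self,
    add_zero, cos_zero, mul_one] at h1 h2
  have h3 : ∀ t : ℝ, Complex.exp ((m : ℂ) * (t * Complex.I)) =
      ((cos (m * t) : ℝ) : ℂ) + ((sin (m * t) : ℝ) : ℂ) * Complex.I := by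
    intro t
    rw [← mul_assoc, Complex.exp_mul_I]
    push_cast
    rfl
  simp_rw [h3]
  rw [integral_add (integrable_of_continuous (by fun_prop))
    (integrable_of_continuous (by fun_prop)), integral_mul_const, integral_complex_ofReal,
    integral_complex_ofReal, h1]
  have h2' : ∫ t, sin (m * t) ∂periodMeasure = 0 := by
    rw [← h2]
  rw [h2']
  split_ifs <;> simp

/-- Parseval's identity for an absolutely convergent power series on a circle. -/
theorem integral_norm_sq_eq_tsum {c : ℕ → ℝ} (hc : Summable fun k => |c k|) {g : ℝ → ℂ}
    (hg : ∀ t : ℝ, HasSum (fun k : ℕ => (c k : ℂ) * Complex.exp (t * Complex.I) ^ k) (g t)) :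
    ∫ t, ‖g t‖ ^ 2 ∂periodMeasure = 2 * π * ∑' k, c k ^ 2 := by
  have hnorm : ∀ (k : ℕ) (t : ℝ), ‖(c k : ℂ) * Complex.exp (t * Complex.I) ^ k‖ ≤ |c k| := by
    intro k t
    rw [norm_mul, norm_pow, Complex.norm_exp_ofReal_mul_I, one_pow, mul_one, Complex.norm_real,
      Real.norm_eq_abs]
  have hgt : g = fun t : ℝ => ∑' k, (c k : ℂ) * Complex.exp (t * Complex.I) ^ k :=
    funext fun t => (hg t).tsum_eq.symm
  have hcont : Continuous g := by
    rw [hgt]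
    exact continuous_tsum (fun k => by fun_prop) hc hnorm
  -- Used twice: u a conjugate power of e^(it) identifies the coefficients, and u the conjugate of g
  -- gives the square norm.
  have hexch : ∀ {u : ℝ → ℂ}, Continuous u → (B : ℝ) → (∀ t, ‖u t‖ ≤ B) →
      HasSum (fun k : ℕ => ∫ t, (c k : ℂ) * Complex.exp (t * Complex.I) ^ k * u t ∂periodMeasure)
        (∫ t, g t * u t ∂periodMeasure) := by
    intro u hu B hB
    have h := hasSum_integral_of_summable_integral_norm (μ := periodMeasure)
      (F := fun (k : ℕ) (t : ℝ) => (c k : ℂ) * Complex.exp (t * Complex.I) ^ k * u t)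
      (fun k => integrable_of_continuous (by fun_prop)) (by
        refine Summable.of_nonneg_of_le (fun k => integral_nonneg fun t => norm_nonneg _)
          (fun k => ?_) (hc.mul_right (∫ _, B ∂periodMeasure))
        rw [← integral_const_mul]
        refine integral_mono (integrable_of_continuous (by fun_prop))
          (integrable_of_continuous (by fun_prop)) fun t => ?_
        rw [norm_mul]
        exact mul_le_mul (hnorm k t) (hB t) (norm_nonneg _) (abs_nonneg _))
    simp only [tsum_mul_right] at h
    rwa [hgt]
  have hin : ∀ j : ℕ, ∫ t, g t * (starRingEnd ℂ) (Complex.exp (t * Complex.I) ^ j)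
      ∂periodMeasure = 2 * π * c j := by
    intro j
    have h := hexch (u := fun t => (starRingEnd ℂ) (Complex.exp (t * Complex.I) ^ j))
      (Complex.continuous_conj.comp (by fun_prop)) 1 (fun t => by
        rw [RCLike.norm_conj, norm_pow, Complex.norm_exp_ofReal_mul_I, one_pow])
    have e : ∀ k : ℕ, ∫ t, (c k : ℂ) * Complex.exp (t * Complex.I) ^ k *
        (starRingEnd ℂ) (Complex.exp (t * Complex.I) ^ j) ∂periodMeasure =
        if k = j then (2 * π * c j : ℂ) else 0 := by
      intro k
      have e1 : ∀ t : ℝ, (c k : ℂ) * Complex.exp (t * Complex.I) ^ k *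
          (starRingEnd ℂ) (Complex.exp (t * Complex.I) ^ j) =
          c k * Complex.exp (((k - j : ℤ) : ℂ) * (t * Complex.I)) := by
        intro t
        rw [map_pow, ← Complex.exp_conj, ← Complex.exp_nat_mul, ← Complex.exp_nat_mul, mul_assoc,
          ← Complex.exp_add]
        simp only [map_mul, Complex.conj_ofReal, Complex.conj_I]
        push_cast
        ring_nf
      simp_rw [e1]
      rw [integral_const_mul, integral_exp_int_mul]
      by_cases hk : k = j
      · subst hk; rw [if_pos (by omega), if_pos rfl]; ring
      · rw [if_neg (by omega), if_neg hk, mul_zero]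
    simp_rw [e] at h
    rw [← h.tsum_eq, tsum_ite_eq]
  obtain ⟨B, hB⟩ : ∃ B : ℝ, ∀ t, ‖g t‖ ≤ B :=
    ⟨∑' k, |c k|, fun t => by
      rw [hgt]
      exact tsum_of_norm_bounded hc.hasSum fun k => hnorm k t⟩
  have h := hexch (u := fun t => (starRingEnd ℂ) (g t)) (Complex.continuous_conj.comp hcont) B
    (fun t => by rw [RCLike.norm_conj]; exact hB t)
  have e2 : ∀ k : ℕ, ∫ t, (c k : ℂ) * Complex.exp (t * Complex.I) ^ k * (starRingEnd ℂ) (g t)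
      ∂periodMeasure = ((2 * π * c k ^ 2 : ℝ) : ℂ) := by
    intro k
    have e3 : ∀ t : ℝ, (c k : ℂ) * Complex.exp (t * Complex.I) ^ k * (starRingEnd ℂ) (g t) =
        c k * (starRingEnd ℂ) (g t * (starRingEnd ℂ) (Complex.exp (t * Complex.I) ^ k)) := by
      intro t; rw [map_mul, Complex.conj_conj]; ring
    simp_rw [e3]
    rw [integral_const_mul, integral_conj, hin k]
    simp only [map_mul, Complex.conj_ofReal, map_ofNat]
    push_cast; ring
  have e4 : ∫ t, g t * (starRingEnd ℂ) (g t) ∂periodMeasure =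
      ((∫ t, ‖g t‖ ^ 2 ∂periodMeasure : ℝ) : ℂ) := by
    rw [← integral_complex_ofReal]
    congr 1 with t
    rw [Complex.mul_conj, Complex.normSq_eq_norm_sq]
  simp_rw [e2, e4] at h
  rw [← tsum_mul_left, (Complex.hasSum_ofReal.1 h).tsum_eq]

/-- The mean value of `|1 - q e^{it}|^{-P}` is a Gauss hypergeometric value. -/
theorem integral_norm_geomFun_rpow {q : ℝ} (hq : 0 ≤ q) (hq1 : q < 1) (P : ℝ) :
    ∫ t, ‖geomFun q t‖ ^ P ∂periodMeasure =
      2 * π * ordinaryHypergeometric (P / 2) (P / 2) (1 : ℝ) (q ^ 2) := by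
  have hc : Summable fun k => |risingCoeff (P / 2) k * q ^ k| := by
    refine (summable_abs_risingCoeff (P / 2) hq hq1).congr fun k => ?_
    rw [abs_mul, abs_of_nonneg (pow_nonneg hq k)]
  -- `‖geomFun q t‖ ^ P` is the squared modulus of (1 - q e^(it))^(-P/2), to which Parseval applies.
  have h := integral_norm_sq_eq_tsum hc
    (g := fun t => 1 / (1 - (q : ℂ) * Complex.exp (t * Complex.I)) ^ ((P / 2 : ℝ) : ℂ))
    (fun t => by
      have h1 := hasSum_risingCoeff (P / 2) (z := (q : ℂ) * Complex.exp (t * Complex.I)) (by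
        rw [norm_mul, Complex.norm_exp_ofReal_mul_I, mul_one, Complex.norm_real, Real.norm_eq_abs,
          abs_of_nonneg hq]
        exact hq1)
      refine (congrArg (fun u => HasSum u _) (funext fun k => ?_)).mpr h1
      push_cast
      rw [mul_pow, mul_assoc])
  rw [ordinaryHypergeometric_eq_tsum_risingCoeff_sq]
  have e1 : ∀ k, risingCoeff (P / 2) k ^ 2 * (q ^ 2) ^ k = (risingCoeff (P / 2) k * q ^ k) ^ 2 := by
    intro k; ring
  simp_rw [e1]
  rw [← h]
  congr 1 with t
  have hpos : 0 < ‖1 - (q : ℂ) * Complex.exp (t * Complex.I)‖ :=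
    norm_pos_iff.2 (one_sub_mul_exp_ne_zero hq hq1 t)
  rw [geomFun, norm_div, norm_one, Complex.norm_cpow_real, norm_inv, inv_rpow hpos.le, one_div,
    inv_pow, ← rpow_natCast, ← rpow_mul hpos.le]
  congr 2
  push_cast; ring

/-! ### The norm of the Poisson-type kernel by averaging over the phase -/

section NormLp

variable {p : ℝ≥0∞} {f g : ℝ → ℝ}

theorem memLp_of_continuous_of_bound (hg : Continuous g) {B : ℝ} (hB : ∀ t, |g t| ≤ B) :
    MemLp g p periodMeasure :=
  MemLp.of_bound hg.aestronglyMeasurable B (ae_of_all _ hB)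

theorem normLp_toReal_rpow (hp : p ≠ 0) (hpt : p ≠ ⊤) (hg : MemLp g p periodMeasure) :
    (normLp p g).toReal ^ p.toReal = ∫ t, |g t| ^ p.toReal ∂periodMeasure := by
  have hP : 0 < p.toReal := ENNReal.toReal_pos hp hpt
  have hI : 0 ≤ ∫ t, |g t| ^ p.toReal ∂periodMeasure :=
    integral_nonneg fun t => rpow_nonneg (abs_nonneg _) _
  rw [normLp, hg.eLpNorm_eq_integral_rpow_norm hp hpt]
  simp only [Real.norm_eq_abs]
  rw [ENNReal.toReal_ofReal (rpow_nonneg hI _), ← rpow_mul hI, inv_mul_cancel₀ hP.ne', rpow_one]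

theorem normLp_toReal_le_add (hp : 1 ≤ p) (hf : MemLp f p periodMeasure)
    (hg : MemLp g p periodMeasure) {M : ℝ} (hM : ∀ t, |f t - g t| ≤ M) :
    (normLp p f).toReal ≤ (normLp p g).toReal + 2 * π * M := by
  have h0 : 0 ≤ M := (abs_nonneg _).trans (hM 0)
  have h1 : normLp p f ≤ normLp p g + normLp p (f - g) := by
    have := eLpNorm_add_le (μ := periodMeasure) hg.1 (hf.sub hg).1 hp
    rwa [add_sub_cancel] at this
  have h2 : normLp p (f - g) ≤ ENNReal.ofReal (2 * π * M) := normLp_le_of_bound hp hM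
  have h3 := h1.trans (add_le_add_right h2 _)
  have hg' : normLp p g ≠ ⊤ := hg.2.ne
  have h4 := ENNReal.toReal_mono (ENNReal.add_ne_top.2 ⟨hg', ENNReal.ofReal_ne_top⟩) h3
  rwa [ENNReal.toReal_add hg' ENNReal.ofReal_ne_top, ENNReal.toReal_ofReal (by positivity)] at h4

end NormLp

section Average

variable {q : ℝ} {n : ℕ} {p : ℝ≥0∞}

theorem memLp_poisson (hq : 0 ≤ q) (hq1 : q < 1) (γ : ℝ) :
    MemLp (poisson q n γ) p periodMeasure :=
  memLp_of_continuous_of_bound (continuous_poisson hq hq1 γ) (abs_poisson_le hq hq1 γ)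

theorem normLp_poisson_toReal_le_add (hq : 0 ≤ q) (hq1 : q < 1) (hp : 1 ≤ p) (γ s : ℝ) :
    (normLp p (poisson q n γ)).toReal ≤ (normLp p (poisson q n (γ - n * s))).toReal +
      2 * π * (q * |s| / (1 - q) ^ 2) := by
  rw [← normLp_comp_add (poisson_periodic γ) (continuous_poisson hq hq1 γ).aestronglyMeasurable s]
  exact normLp_toReal_le_add hp (memLp_comp_add (poisson_periodic γ) (memLp_poisson hq hq1 γ) s)
    (memLp_poisson hq hq1 _) fun t => abs_poisson_shift_sub_le hq hq1 γ t s

/-- Changing the phase by ω amounts to translating by ω/n, up to the slow factor, and translation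
keeps the norm. The one-sided estimate is applied in both directions. -/
theorem abs_normLp_poisson_sub_le (hq : 0 ≤ q) (hq1 : q < 1) (hp : 1 ≤ p) (hn : 0 < n) (γ : ℝ)
    {ω : ℝ} (hω : |ω| ≤ π) :
    |(normLp p (poisson q n (γ - ω))).toReal - (normLp p (poisson q n γ)).toReal| ≤
      2 * π * (q * (π / n) / (1 - q) ^ 2) := by
  have hn' : (0 : ℝ) < n := by exact_mod_cast hn
  have hs : |ω / n| ≤ π / n := by
    rw [abs_div, abs_of_pos hn']; gcongr
  have hs2 : 2 * π * (q * |ω / n| / (1 - q) ^ 2) ≤ 2 * π * (q * (π / n) / (1 - q) ^ 2) := by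
    gcongr
  have h1 := normLp_poisson_toReal_le_add (n := n) hq hq1 hp γ (ω / n)
  have h2 := normLp_poisson_toReal_le_add (n := n) hq hq1 hp (γ - ω) (-(ω / n))
  have e1 : γ - n * (ω / n) = γ - ω := by field_simp
  have e2 : γ - ω - n * -(ω / n) = γ := by field_simp; ring
  rw [e1] at h1
  rw [e2, abs_neg] at h2
  rw [abs_le]
  constructor <;> linarith

/-- For fixed t the argument of `geomFun` merely translates the phase variable, and integration over
a full period erases it. -/
theorem integral_abs_poisson_rpow_phase {P : ℝ} (γ t : ℝ) :
    ∫ ω, |poisson q n (γ - ω) t| ^ P ∂periodMeasure =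
      ‖geomFun q t‖ ^ P * ∫ ω, |cos ω| ^ P ∂periodMeasure := by
  have h : ∀ ω, |poisson q n (γ - ω) t| ^ P =
      ‖geomFun q t‖ ^ P * |cos (ω + (n * t + Complex.arg (geomFun q t) - γ))| ^ P := by
    intro ω
    rw [poisson_eq_norm_mul_cos, abs_mul, abs_norm, mul_rpow (norm_nonneg _) (abs_nonneg _)]
    congr 4; ring
  simp_rw [h]
  rw [integral_const_mul]
  congr 1
  exact integral_comp_add (g := fun ω => |cos ω| ^ P)
    (fun ω => by simp only [cos_add_two_pi]) _

theorem integrable_abs_poisson_rpow_prod (hq : 0 ≤ q) (hq1 : q < 1) {P : ℝ} (hP : 0 ≤ P) (γ : ℝ) :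
    Integrable (fun x : ℝ × ℝ => |poisson q n (γ - x.1) x.2| ^ P)
      (periodMeasure.prod periodMeasure) := by
  have hc : Continuous fun x : ℝ × ℝ => |poisson q n (γ - x.1) x.2| ^ P := by
    have h := (continuous_poisson_uncurry (n := n) hq hq1).comp
      (((continuous_const (y := γ)).sub (continuous_fst (X := ℝ) (Y := ℝ))).prodMk continuous_snd)
    exact h.abs.rpow_const fun _ => Or.inr hP
  refine Integrable.of_bound hc.aestronglyMeasurable ((1 / (1 - q)) ^ P) (ae_of_all _ fun x => ?_)
  rw [Real.norm_eq_abs, abs_of_nonneg (rpow_nonneg (abs_nonneg _) _)]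
  exact rpow_le_rpow (abs_nonneg _) (abs_poisson_le hq hq1 _ _) hP

/-- Averaging the `P`-th power of the norm over the phase decouples modulus and argument. -/
theorem integral_integral_abs_poisson_rpow (hq : 0 ≤ q) (hq1 : q < 1) {P : ℝ} (hP : 0 ≤ P)
    (γ : ℝ) :
    ∫ ω, ∫ t, |poisson q n (γ - ω) t| ^ P ∂periodMeasure ∂periodMeasure =
      (∫ t, ‖geomFun q t‖ ^ P ∂periodMeasure) * ∫ ω, |cos ω| ^ P ∂periodMeasure := by
  rw [integral_integral_swap (integrable_abs_poisson_rpow_prod hq hq1 hP γ)]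
  simp_rw [integral_abs_poisson_rpow_phase]
  rw [integral_mul_const]

theorem periodMeasure_real_univ : periodMeasure.real Set.univ = 2 * π := by
  rw [Measure.real, periodMeasure_univ, ENNReal.toReal_ofReal (by positivity)]

theorem ae_abs_le_pi : ∀ᵐ ω ∂periodMeasure, |ω| ≤ π := by
  filter_upwards [ae_restrict_mem (μ := volume) (measurableSet_Ioc (a := -π) (b := π))] with ω h
  exact abs_le.2 ⟨h.1.le, h.2⟩

/-- The `L_p` norm of the Poisson-type kernel, up to `O(q / n)`. -/
theorem abs_normLp_poisson_sub_hypergeometric_le (hq : 0 ≤ q) (hq1 : q < 1) (hp : 1 ≤ p)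
    (hpt : p ≠ ⊤) (hn : 0 < n) (γ : ℝ) :
    |(normLp p (poisson q n γ)).toReal - (normLp p cos).toReal *
      (ordinaryHypergeometric (p.toReal / 2) (p.toReal / 2) (1 : ℝ) (q ^ 2)) ^ (1 / p.toReal)| ≤
      2 * π * (q * (π / n) / (1 - q) ^ 2) := by
  have hp0 : p ≠ 0 := (zero_lt_one.trans_le hp).ne'
  have hP : 0 < p.toReal := ENNReal.toReal_pos hp0 hpt
  set P := p.toReal with hPdef
  set δ := 2 * π * (q * (π / n) / (1 - q) ^ 2) with hδ
  set F := ordinaryHypergeometric (P / 2) (P / 2) (1 : ℝ) (q ^ 2) with hF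
  set M := fun γ => (normLp p (poisson q n γ)).toReal with hM
  set A := (normLp p cos).toReal * F ^ (1 / P) with hA
  have hδ0 : 0 ≤ δ := by positivity
  have hM0 : ∀ γ, 0 ≤ M γ := fun γ => ENNReal.toReal_nonneg
  have hMP : ∀ γ, M γ ^ P = ∫ t, |poisson q n γ t| ^ P ∂periodMeasure := fun γ =>
    normLp_toReal_rpow hp0 hpt (memLp_poisson hq hq1 γ)
  have hgeom := integral_norm_geomFun_rpow hq hq1 P
  have hF0 : 0 ≤ F := by
    have h : 0 ≤ 2 * π * F := by
      rw [hF, ← hgeom]; exact integral_nonneg fun t => rpow_nonneg (norm_nonneg _) _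
    exact nonneg_of_mul_nonneg_right h (by positivity)
  have hA0 : 0 ≤ A := mul_nonneg ENNReal.toReal_nonneg (rpow_nonneg hF0 _)
  have hAP : A ^ P = (∫ ω, |cos ω| ^ P ∂periodMeasure) * F := by
    rw [hA, mul_rpow ENNReal.toReal_nonneg (rpow_nonneg hF0 _), ← rpow_mul hF0,
      one_div_mul_cancel hP.ne', rpow_one,
      normLp_toReal_rpow hp0 hpt (memLp_of_continuous_of_bound continuous_cos abs_cos_le_one)]
  -- Thus A is the P-mean of the norms over all phases. Each of these lies within δ of M γ, hence so
  -- does A.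
  have hAvg : ∫ ω, M (γ - ω) ^ P ∂periodMeasure = 2 * π * A ^ P := by
    simp_rw [hMP]
    rw [integral_integral_abs_poisson_rpow hq hq1 hP.le, hgeom, hAP]; ring
  have hint : Integrable (fun ω => M (γ - ω) ^ P) periodMeasure := by
    simp_rw [hMP]
    exact (integrable_abs_poisson_rpow_prod hq hq1 hP.le γ).integral_prod_left
  have hconst : ∀ c : ℝ, ∫ _, c ∂periodMeasure = 2 * π * c := by
    intro c; rw [integral_const, periodMeasure_real_univ, smul_eq_mul]
  have hclose : ∀ᵐ ω ∂periodMeasure, |M (γ - ω) - M γ| ≤ δ := by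
    filter_upwards [ae_abs_le_pi] with ω hω
    exact abs_normLp_poisson_sub_le hq hq1 hp hn γ hω
  have h2pi : 0 < 2 * π := Real.two_pi_pos
  have hup : A ≤ M γ + δ := by
    have h : ∫ ω, M (γ - ω) ^ P ∂periodMeasure ≤ ∫ _, (M γ + δ) ^ P ∂periodMeasure := by
      refine integral_mono_ae hint (integrable_const _) ?_
      filter_upwards [hclose] with ω hω
      exact rpow_le_rpow (hM0 _) (by linarith [(abs_le.1 hω).2]) hP.le
    rw [hAvg, hconst] at h
    exact (rpow_le_rpow_iff hA0 (add_nonneg (hM0 _) hδ0) hP).1 (le_of_mul_le_mul_left h h2pi)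
  have hlo : M γ - δ ≤ A := by
    -- Powers can be compared only for a nonnegative base; otherwise A ≥ 0 suffices.
    rcases le_or_gt (M γ - δ) 0 with h0 | h0
    · exact h0.trans hA0
    have h : ∫ _, (M γ - δ) ^ P ∂periodMeasure ≤ ∫ ω, M (γ - ω) ^ P ∂periodMeasure := by
      refine integral_mono_ae (integrable_const _) hint ?_
      filter_upwards [hclose] with ω hω
      exact rpow_le_rpow h0.le (by linarith [(abs_le.1 hω).1]) hP.le
    rw [hAvg, hconst] at h
    exact (rpow_le_rpow_iff h0.le hA0 hP).1 (le_of_mul_le_mul_left h h2pi)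
  rw [abs_le]
  constructor <;> linarith

end Average

/-! ### Duality: bounds for the deviation from above and below -/

section Deviation

variable {r β : ℝ} {m : ℕ} {p p' : ℝ≥0∞}

theorem fourierDeviation_le (hr : 1 < r) [ENNReal.HolderConjugate p p'] (hp : 1 ≤ p)
    {D : ℝ} (hD : normLp p' (tailKernel r β m) ≤ ENNReal.ofReal D) :
    fourierDeviation (m + 1) (weylNagyClass r β p) ≤ ENNReal.ofReal (1 / π * D) := by
  refine iSup₂_le fun f hf => iSup_le fun x => ?_
  obtain ⟨a, φ, ⟨hper, hmem, hnorm, -⟩, hf⟩ := hf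
  change ENNReal.ofReal |f x - fourierSum (m + 1 - 1) f x| ≤ _
  rw [Nat.add_sub_cancel, sub_fourierSum_eq hr hper (hmem.integrable hp) hf, abs_mul,
    abs_of_pos (show (0 : ℝ) < 1 / π by positivity), ENNReal.ofReal_mul (by positivity),
    ENNReal.ofReal_mul (by positivity)]
  refine mul_le_mul' le_rfl ?_
  calc _ ≤ normLp p (fun t => φ (x - t)) * normLp p' (tailKernel r β m) :=
        abs_integral_mul_le (memLp_comp_sub hper hmem x).1
          (continuous_tailKernel hr m).aestronglyMeasurable
    _ ≤ 1 * ENNReal.ofReal D := by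
        refine mul_le_mul' ?_ hD
        rwa [normLp_comp_sub hper hmem.1]
    _ = _ := one_mul _

/-- Taking φ to be the reflection of ψ and evaluating at x = 0 turns the convolution into a pairing
with ψ. -/
theorem ofReal_le_fourierDeviation (hr : 1 < r) (hp : 1 ≤ p) {ψ : ℝ → ℝ}
    (hper : Function.Periodic ψ (2 * π)) (hmem : MemLp ψ p periodMeasure)
    (hnorm : normLp p ψ ≤ 1) (hzero : ∫ t, ψ t ∂periodMeasure = 0) :
    ENNReal.ofReal (1 / π * ∫ t, ψ t * tailKernel r β m t ∂periodMeasure) ≤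
      fourierDeviation (m + 1) (weylNagyClass r β p) := by
  set φ : ℝ → ℝ := fun t => ψ (0 - t) with hφ
  have hφper : Function.Periodic φ (2 * π) := by
    intro t
    simp only [hφ]
    rw [← hper (0 - (t + 2 * π))]
    congr 1; ring
  have hφmem : MemLp φ p periodMeasure := memLp_comp_sub hper hmem 0
  set f : ℝ → ℝ := fun x => (0 : ℝ) / 2 + (1 / π) * ∫ t in (-π)..π, φ (x - t) * kernel r β t
    with hf
  have hfmem : f ∈ weylNagyClass r β p := by
    refine ⟨0, φ, ⟨hφper, hφmem, ?_, ?_⟩, fun x => rfl⟩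
    · rwa [hφ, normLp_comp_sub hper hmem.1]
    · rw [intervalIntegral_eq_integral_periodMeasure, ← hzero]
      exact integral_comp_sub hper 0
  refine le_trans ?_ (le_iSup₂ (f := fun f (_ : f ∈ weylNagyClass r β p) =>
    normC fun x => f x - fourierSum (m + 1 - 1) f x) f hfmem)
  refine le_trans ?_ (le_iSup (fun x => ENNReal.ofReal |f x - fourierSum (m + 1 - 1) f x|) 0)
  rw [Nat.add_sub_cancel, sub_fourierSum_eq hr hφper (hφmem.integrable hp) (fun x => rfl)]
  simp only [hφ, zero_sub, neg_neg]
  exact ENNReal.ofReal_le_ofReal (le_abs_self _)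

/-- Testing against an arbitrary function of the unit ball, after antisymmetrization by the shift
by half a period of the leading harmonic. -/
theorem ofReal_le_fourierDeviation_of_approx (hr : 1 < r) (hp : 1 ≤ p) {ψ K : ℝ → ℝ}
    {s δ ε c : ℝ}
    (hper : Function.Periodic ψ (2 * π)) (hmem : MemLp ψ p periodMeasure)
    (hnorm : normLp p ψ ≤ 1) (hKc : Continuous K) (hKper : Function.Periodic K (2 * π))
    (hshift : ∀ t, |K (t + s) + K t| ≤ δ) (hc : 0 < c)
    (happrox : ∀ t, |c * tailKernel r β m t - K t| ≤ ε) :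
    ENNReal.ofReal (1 / π * (c⁻¹ * ((∫ t, ψ t * K t ∂periodMeasure) - π * δ - 2 * π * ε))) ≤
      fourierDeviation (m + 1) (weylNagyClass r β p) := by
  set ψ' : ℝ → ℝ := fun t => ψ (t + -s) with hψ'
  have hper' : Function.Periodic ψ' (2 * π) := by
    intro t
    simp only [hψ']
    rw [← hper (t + -s)]
    congr 1; ring
  have hmem' : MemLp ψ' p periodMeasure := memLp_comp_add hper hmem _
  have hnorm' : normLp p ψ' ≤ 1 := by rwa [hψ', normLp_comp_add hper hmem.1]
  -- The half-difference has mean zero and norm at most 1. Its pairing with K is half of ∫ ψ(t)(K(t)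
  -- - K(t + s)) dt; as K(t + s) ≈ -K(t), the loss against ∫ ψK is at most (δ/2)∫|ψ| ≤ πδ.
  set χ : ℝ → ℝ := (1 / 2 : ℝ) • (ψ - ψ') with hχ
  have hχt : ∀ t, χ t = 1 / 2 * (ψ t - ψ' t) := fun t => rfl
  have hχper : Function.Periodic χ (2 * π) := by
    intro t; rw [hχt, hχt, hper t, hper' t]
  have hχmem : MemLp χ p periodMeasure := (hmem.sub hmem').const_smul _
  have hint := hmem.integrable hp
  have hint' := hmem'.integrable hp
  have hχnorm : normLp p χ ≤ 1 := by
    have h1 : normLp p (ψ - ψ') ≤ 2 := by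
      refine (eLpNorm_sub_le hmem.1 hmem'.1 hp).trans ?_
      rw [← one_add_one_eq_two]
      exact add_le_add hnorm hnorm'
    rw [normLp, hχ, eLpNorm_const_smul]
    refine (mul_le_mul' le_rfl h1).trans (le_of_eq ?_)
    rw [← ofReal_norm, Real.norm_eq_abs, abs_of_pos (by norm_num : (0 : ℝ) < 1 / 2),
      show (2 : ℝ≥0∞) = ENNReal.ofReal 2 by simp, ← ENNReal.ofReal_mul (by norm_num)]
    norm_num
  have hχzero : ∫ t, χ t ∂periodMeasure = 0 := by
    simp_rw [hχt]
    rw [integral_const_mul, integral_sub hint hint', integral_comp_add hper, sub_self, mul_zero]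
  refine le_trans (ENNReal.ofReal_le_ofReal ?_)
    (ofReal_le_fourierDeviation hr hp hχper hχmem hχnorm hχzero)
  obtain ⟨B, hB⟩ : ∃ B, ∀ t, |K t| ≤ B := by
    obtain ⟨B, hB⟩ := (isCompact_Icc (a := (-π)) (b := π)).exists_bound_of_continuousOn
      hKc.continuousOn
    refine ⟨B, fun t => ?_⟩
    rw [← apply_reduce hKper]
    have h := toIocMod_mem_Ioc Real.two_pi_pos (-π) t
    exact hB _ ⟨h.1.le, by
      have := h.2
      rw [show -π + 2 * π = π by ring] at this
      exact this⟩
  have hδ0 : ∀ t, |K (t + s)| ≤ B := fun t => hB _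
  have hψK : Integrable (fun t => ψ t * K t) periodMeasure := integrable_mul_of_bound hint hKc hB
  have hψ'K : Integrable (fun t => ψ' t * K t) periodMeasure :=
    integrable_mul_of_bound hint' hKc hB
  have hKs : Continuous fun t => K (t + s) := by fun_prop
  have hψKs : Integrable (fun t => ψ t * K (t + s)) periodMeasure :=
    integrable_mul_of_bound hint hKs hδ0
  have e1 : ∫ t, ψ' t * K t ∂periodMeasure = ∫ t, ψ t * K (t + s) ∂periodMeasure := by
    have := integral_comp_add (g := fun t => ψ t * K (t + s)) (fun t => by
      have h : t + 2 * π + s = t + s + 2 * π := by ring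
      simp only [hper t, h, hKper (t + s)]) (-s)
    simpa [hψ'] using this
  have habs := integral_abs_le hp hmem hnorm
  have hχabs := integral_abs_le hp hχmem hχnorm
  have hχint := hχmem.integrable hp
  have hχK : ∫ t, χ t * K t ∂periodMeasure =
      1 / 2 * ((∫ t, ψ t * K t ∂periodMeasure) - ∫ t, ψ t * K (t + s) ∂periodMeasure) := by
    rw [← e1, ← integral_sub hψK hψ'K, ← integral_const_mul]
    congr 1 with t
    rw [hχt]; ring
  have hδnn : 0 ≤ δ := (abs_nonneg _).trans (hshift 0)
  have hεnn : 0 ≤ ε := (abs_nonneg _).trans (happrox 0)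
  have h1 : |∫ t, ψ t * (K (t + s) + K t) ∂periodMeasure| ≤ 2 * π * δ := by
    have h : |∫ t, ψ t * (K (t + s) + K t) ∂periodMeasure| ≤ ∫ t, |ψ t| * δ ∂periodMeasure := by
      rw [← Real.norm_eq_abs]
      refine norm_integral_le_of_norm_le (hint.abs.mul_const _) (ae_of_all _ fun t => ?_)
      rw [Real.norm_eq_abs, abs_mul]
      exact mul_le_mul_of_nonneg_left (hshift t) (abs_nonneg _)
    rw [integral_mul_const] at h
    exact h.trans (mul_le_mul_of_nonneg_right habs hδnn)
  have e2 : ∫ t, ψ t * (K (t + s) + K t) ∂periodMeasure =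
      (∫ t, ψ t * K (t + s) ∂periodMeasure) + ∫ t, ψ t * K t ∂periodMeasure := by
    rw [← integral_add hψKs hψK]
    simp_rw [mul_add]
  have hTc := continuous_tailKernel (β := β) hr m
  have h2 : |∫ t, χ t * (c * tailKernel r β m t - K t) ∂periodMeasure| ≤ 2 * π * ε := by
    have h : |∫ t, χ t * (c * tailKernel r β m t - K t) ∂periodMeasure| ≤
        ∫ t, |χ t| * ε ∂periodMeasure := by
      rw [← Real.norm_eq_abs]
      refine norm_integral_le_of_norm_le (hχint.abs.mul_const _) (ae_of_all _ fun t => ?_)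
      rw [Real.norm_eq_abs, abs_mul]
      exact mul_le_mul_of_nonneg_left (happrox t) (abs_nonneg _)
    rw [integral_mul_const] at h
    exact h.trans (mul_le_mul_of_nonneg_right hχabs hεnn)
  have e3 : c * ∫ t, χ t * tailKernel r β m t ∂periodMeasure =
      (∫ t, χ t * (c * tailKernel r β m t - K t) ∂periodMeasure) +
        ∫ t, χ t * K t ∂periodMeasure := by
    rw [← integral_add (integrable_mul_of_bound hχint (by fun_prop) happrox)
      (integrable_mul_of_bound hχint hKc hB), ← integral_const_mul]
    congr 1 with t
    ring
  have h3 : (∫ t, ψ t * K t ∂periodMeasure) - π * δ - 2 * π * ε ≤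
      c * ∫ t, χ t * tailKernel r β m t ∂periodMeasure := by
    rw [e3, hχK]
    rw [e2] at h1
    linarith [(abs_le.1 h1).2, (abs_le.1 h2).1]
  refine mul_le_mul_of_nonneg_left ?_ (by positivity)
  calc _ ≤ c⁻¹ * (c * ∫ t, χ t * tailKernel r β m t ∂periodMeasure) :=
        mul_le_mul_of_nonneg_left h3 (inv_pos.2 hc).le
    _ = _ := inv_mul_cancel_left₀ hc.ne' _

end Deviation

/-! ### Extremal and near-extremal functions -/

section Extremal

variable {p p' : ℝ≥0∞} {g : ℝ → ℝ}

/-- Extremal functions in Hölder's inequality, `1 < p ≤ ∞`. -/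
theorem exists_extremal (hp : 1 < p) (hpp : p⁻¹ + p'⁻¹ = 1) (hp' : 1 ≤ p') (hpt' : p' ≠ ⊤)
    (hg : Continuous g) (hgper : Function.Periodic g (2 * π))
    (hmem : MemLp g p' periodMeasure) :
    ∃ ψ : ℝ → ℝ, Function.Periodic ψ (2 * π) ∧ MemLp ψ p periodMeasure ∧ normLp p ψ ≤ 1 ∧
      ∫ t, ψ t * g t ∂periodMeasure = (normLp p' g).toReal := by
  set Q := p'.toReal with hQ
  have hp0' : p' ≠ 0 := (zero_lt_one.trans_le hp').ne'
  have hp0 : p ≠ 0 := (zero_lt_one.trans hp).ne'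
  have hQ0 : 0 < Q := ENNReal.toReal_pos hp0' hpt'
  set D := (normLp p' g).toReal with hD
  have hDQ : D ^ Q = ∫ t, |g t| ^ Q ∂periodMeasure := normLp_toReal_rpow hp0' hpt' hmem
  rcases (show 0 ≤ D from ENNReal.toReal_nonneg).eq_or_lt with hD0 | hD0
  · refine ⟨0, fun t => rfl, MemLp.zero', ?_, ?_⟩
    · simp [normLp]
    · simp [← hD0]
  -- This is sign(g)|g|^(Q-1), normalized. The factor g makes it vanish at zeros of g whatever value
  -- the power takes there, also when Q < 2.
  set ψ : ℝ → ℝ := fun t => g t * |g t| ^ (Q - 2) / D ^ (Q - 1) with hψ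
  have hψmeas : Measurable ψ := by
    have := hg.measurable
    simp only [hψ]
    fun_prop
  have hψabs : ∀ t, |ψ t| ≤ |g t| ^ (Q - 1) / D ^ (Q - 1) := by
    intro t
    rw [hψ]
    simp only
    rw [abs_div, abs_of_pos (rpow_pos_of_pos hD0 _), abs_mul,
      abs_of_nonneg (rpow_nonneg (abs_nonneg (g t)) _)]
    refine div_le_div_of_nonneg_right ?_ (rpow_pos_of_pos hD0 _).le
    rcases (abs_nonneg (g t)).eq_or_lt with h0 | h0
    · rw [← h0, zero_mul]; exact rpow_nonneg le_rfl _
    · nth_rewrite 1 [← rpow_one |g t|]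
      rw [← rpow_add h0]
      exact le_of_eq (by congr 1; ring)
  have hψg : ∀ t, ψ t * g t = |g t| ^ Q / D ^ (Q - 1) := by
    intro t
    rw [hψ]
    simp only
    rcases (abs_nonneg (g t)).eq_or_lt with h0 | h0
    · rw [← h0, zero_rpow hQ0.ne', abs_eq_zero.1 h0.symm]; simp
    · have : |g t| ^ Q = g t * |g t| ^ (Q - 2) * g t := by
        rw [mul_right_comm, ← abs_mul_abs_self (g t), ← sq, ← rpow_natCast, ← rpow_add h0]
        congr 1; push_cast; ring
      rw [this]; ring
  have hnorm : normLp p ψ ≤ 1 := by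
    rcases eq_or_ne p ⊤ with rfl | hpt
    · have hp1 : p' = 1 := by
        rw [ENNReal.inv_top, zero_add] at hpp
        exact ENNReal.inv_eq_one.1 hpp
      have hQ1 : Q - 1 = 0 := by rw [hQ, hp1]; simp
      rw [normLp]
      refine (eLpNorm_le_of_ae_bound (C := 1) (ae_of_all _ fun t => ?_)).trans ?_
      · have := hψabs t
        rwa [hQ1, rpow_zero, rpow_zero, div_one] at this
      · simp
    · have hP0 : 0 < p.toReal := ENNReal.toReal_pos hp0 hpt
      have hconj : (Q - 1) * p.toReal = Q := by
        have h := congrArg ENNReal.toReal hpp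
        rw [ENNReal.toReal_add (ENNReal.inv_ne_top.2 hp0) (ENNReal.inv_ne_top.2 hp0'),
          ENNReal.toReal_inv, ENNReal.toReal_inv, ENNReal.toReal_one, ← hQ] at h
        field_simp at h
        linarith
      have hle : ∀ t, |ψ t| ^ p.toReal ≤ |g t| ^ Q / D ^ Q := by
        intro t
        refine (rpow_le_rpow (abs_nonneg _) (hψabs t) hP0.le).trans (le_of_eq ?_)
        rw [div_rpow (rpow_nonneg (abs_nonneg _) _) (rpow_nonneg hD0.le _),
          ← rpow_mul (abs_nonneg _), ← rpow_mul hD0.le, hconj]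
      have hgQ : Integrable (fun t => |g t| ^ Q / D ^ Q) periodMeasure :=
        integrable_of_continuous ((hg.abs.rpow_const fun _ => Or.inr hQ0.le).div_const _)
      rw [normLp, eLpNorm_eq_lintegral_rpow_enorm_toReal hp0 hpt]
      refine ENNReal.rpow_le_one ?_ (by positivity)
      calc ∫⁻ t, ‖ψ t‖ₑ ^ p.toReal ∂periodMeasure
          ≤ ∫⁻ t, ENNReal.ofReal (|g t| ^ Q / D ^ Q) ∂periodMeasure := by
            refine lintegral_mono fun t => ?_
            rw [← ofReal_norm, ENNReal.ofReal_rpow_of_nonneg (norm_nonneg _) hP0.le]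
            exact ENNReal.ofReal_le_ofReal (hle t)
        _ = ENNReal.ofReal (∫ t, |g t| ^ Q / D ^ Q ∂periodMeasure) :=
            (ofReal_integral_eq_lintegral_ofReal hgQ
              (ae_of_all _ fun t => by positivity)).symm
        _ = 1 := by
            rw [integral_div, ← hDQ, div_self (rpow_pos_of_pos hD0 _).ne', ENNReal.ofReal_one]
  refine ⟨ψ, fun t => ?_, ⟨hψmeas.aestronglyMeasurable, hnorm.trans_lt ENNReal.one_lt_top⟩,
    hnorm, ?_⟩
  · simp only [hψ, hgper t]
  · simp_rw [hψg]
    rw [integral_div, ← hDQ, ← rpow_sub hD0, sub_sub_cancel, rpow_one]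

theorem reduce_ae_eq : ∀ᵐ t ∂periodMeasure, reduce t = t := by
  filter_upwards [ae_restrict_mem (μ := volume) (measurableSet_Ioc (a := -π) (b := π))] with t h
  rw [reduce, toIocMod_eq_self, show -π + 2 * π = π by ring]
  exact h

/-- Approximate identities: near-extremal functions for `p = 1`. -/
theorem exists_near_extremal_one (hg : Continuous g) (hgper : Function.Periodic g (2 * π))
    (x : ℝ) {η : ℝ} (hη : 0 < η) :
    ∃ ψ : ℝ → ℝ, Function.Periodic ψ (2 * π) ∧ MemLp ψ 1 periodMeasure ∧ normLp 1 ψ ≤ 1 ∧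
      g x - η ≤ ∫ t, ψ t * g t ∂periodMeasure := by
  set u := reduce x with hu
  have hgu : g u = g x := apply_reduce hgper x
  have humem : u ∈ Set.Ioc (-π) π := by
    have := toIocMod_mem_Ioc Real.two_pi_pos (-π) x
    rwa [show -π + 2 * π = π by ring] at this
  obtain ⟨d, hd0, hd⟩ := Metric.continuous_iff.1 hg u η hη
  -- The interval (u - δ, u] must lie within the continuity radius and inside the period. It extends
  -- only to the left because u may equal π.
  set δ := min d (u + π) / 2 with hδ
  have hmin : 0 < min d (u + π) := lt_min hd0 (by linarith [humem.1])
  have hδ0 : 0 < δ := by positivity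
  have hδd : δ < d := by linarith [min_le_left d (u + π)]
  have hδu : -π < u - δ := by linarith [min_le_right d (u + π)]
  set J := Set.Ioc (u - δ) u with hJ
  have hJm : MeasurableSet J := measurableSet_Ioc
  have hJsub : J ⊆ Set.Ioc (-π) π := fun t ht => ⟨hδu.trans ht.1, ht.2.trans humem.2⟩
  have hJμ : periodMeasure J = ENNReal.ofReal δ := by
    rw [periodMeasure, Measure.restrict_apply hJm, Set.inter_eq_left.2 hJsub, hJ,
      Real.volume_Ioc, sub_sub_cancel]
  set ψ₁ : ℝ → ℝ := J.indicator fun _ => 1 / δ with hψ₁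
  have hae : (fun t => ψ₁ (reduce t)) =ᵐ[periodMeasure] ψ₁ := by
    filter_upwards [reduce_ae_eq] with t ht
    rw [ht]
  have hψ₁int : Integrable ψ₁ periodMeasure := (integrable_const _).indicator hJm
  have hψ₁norm : normLp 1 ψ₁ = 1 := by
    rw [normLp, hψ₁, eLpNorm_indicator_const hJm one_ne_zero ENNReal.one_ne_top, hJμ,
      ENNReal.toReal_one, div_one, ENNReal.rpow_one, ← ofReal_norm, Real.norm_eq_abs,
      abs_of_pos (by positivity), ← ENNReal.ofReal_mul (by positivity),
      one_div_mul_cancel hδ0.ne', ENNReal.ofReal_one]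
  have hψ₁one : ∫ t, ψ₁ t ∂periodMeasure = 1 := by
    rw [hψ₁, integral_indicator_const _ hJm, Measure.real, hJμ, ENNReal.toReal_ofReal hδ0.le,
      smul_eq_mul, mul_one_div_cancel hδ0.ne']
  have hprod : (fun t => ψ₁ t * g t) = J.indicator fun t => 1 / δ * g t := by
    ext t
    by_cases ht : t ∈ J <;> simp [hψ₁, ht]
  have hprodint : Integrable (fun t => ψ₁ t * g t) periodMeasure := by
    rw [hprod]
    exact (integrable_of_continuous (by fun_prop)).indicator hJm
  -- Composing with `reduce` makes the bump periodic and changes nothing almost everywhere on the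
  -- period.
  refine ⟨fun t => ψ₁ (reduce t), fun t => ?_, ?_, ?_, ?_⟩
  · simp only [reduce, toIocMod_add_right]
  · exact (memLp_congr_ae hae).2 (memLp_one_iff_integrable.2 hψ₁int)
  · rw [normLp, eLpNorm_congr_ae hae]
    exact hψ₁norm.le
  · have e : ∫ t, ψ₁ (reduce t) * g t ∂periodMeasure = ∫ t, ψ₁ t * g t ∂periodMeasure := by
      refine integral_congr_ae ?_
      filter_upwards [hae] with t ht
      rw [ht]
    rw [e, ← one_mul (g x - η), ← hψ₁one, ← integral_mul_const]
    refine integral_mono (hψ₁int.mul_const _) hprodint fun t => ?_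
    by_cases ht : t ∈ J
    · have hdist : dist t u < d := by
        rw [Real.dist_eq, abs_lt]
        constructor <;> linarith [ht.1, ht.2]
      have h := hd t hdist
      rw [Real.dist_eq, abs_lt, hgu] at h
      have hψt : ψ₁ t = 1 / δ := Set.indicator_of_mem ht _
      simp only [hψt]
      exact mul_le_mul_of_nonneg_left (by linarith [h.1]) (by positivity)
    · have hψt : ψ₁ t = 0 := Set.indicator_of_notMem ht _
      simp [hψt]

end Extremal

/-! ### Passage from the tail kernel to the Poisson-type kernel -/

section Kernel

variable {r β q ε : ℝ} {m : ℕ} {p p' : ℝ≥0∞}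

theorem normLp_tailKernel_le (hr : 1 < r) (hq : 0 ≤ q) (hq1 : q < 1) (hp' : 1 ≤ p')
    (happrox : ∀ t, |((m + 1 : ℕ) : ℝ) ^ r * tailKernel r β m t -
      poisson q (m + 1) (β * π / 2) t| ≤ ε) :
    normLp p' (tailKernel r β m) ≤ ENNReal.ofReal (((m + 1 : ℕ) : ℝ) ^ (-r) *
      ((normLp p' (poisson q (m + 1) (β * π / 2))).toReal + 2 * π * ε)) := by
  set c := ((m + 1 : ℕ) : ℝ) ^ r with hc
  have hc0 : 0 < c := by positivity
  have hcinv : ((m + 1 : ℕ) : ℝ) ^ (-r) = c⁻¹ := rpow_neg (by positivity) _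
  have hT := continuous_tailKernel (β := β) hr m
  have hTmem : MemLp (c • tailKernel r β m) p' periodMeasure := by
    refine memLp_of_continuous_of_bound (B := 1 / (1 - q) + ε) (hT.const_smul c) fun t => ?_
    have h1 := happrox t
    have h2 := abs_poisson_le (n := m + 1) hq hq1 (β * π / 2) t
    have h3 := abs_sub_abs_le_abs_sub (c * tailKernel r β m t) (poisson q (m + 1) (β * π / 2) t)
    simp only [Pi.smul_apply, smul_eq_mul]
    linarith
  have h := normLp_toReal_le_add hp' hTmem (memLp_poisson hq hq1 _) happrox
  have h2 : normLp p' (tailKernel r β m) =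
      ENNReal.ofReal c⁻¹ * normLp p' (c • tailKernel r β m) := by
    rw [normLp, normLp, eLpNorm_const_smul, ← mul_assoc, ← ofReal_norm, Real.norm_eq_abs,
      abs_of_pos hc0, ← ENNReal.ofReal_mul (by positivity), inv_mul_cancel₀ hc0.ne',
      ENNReal.ofReal_one, one_mul]
  rw [h2, hcinv, ENNReal.ofReal_mul (by positivity)]
  refine mul_le_mul' le_rfl ?_
  rw [← ENNReal.ofReal_toReal (show normLp p' (c • tailKernel r β m) ≠ ⊤ from hTmem.2.ne)]
  exact ENNReal.ofReal_le_ofReal h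

/-- Translation by π/(m + 1) moves the phase by π and so reverses the sign, up to the slow factor.
This near antiperiodicity makes the antisymmetrization cheap. -/
theorem abs_poisson_half_shift_add_le (hq : 0 ≤ q) (hq1 : q < 1) (γ t : ℝ) :
    |poisson q (m + 1) γ (t + π / (m + 1 : ℕ)) + poisson q (m + 1) γ t| ≤
      q * (π / (m + 1 : ℕ)) / (1 - q) ^ 2 := by
  have h := abs_poisson_shift_sub_le (n := m + 1) hq hq1 γ t (π / (m + 1 : ℕ))
  have e : γ - ((m + 1 : ℕ) : ℝ) * (π / (m + 1 : ℕ)) = γ - π := by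
    rw [mul_div_cancel₀ _ (by positivity)]
  rw [e, poisson_sub_pi, sub_neg_eq_add, abs_of_nonneg (show 0 ≤ π / ((m + 1 : ℕ) : ℝ) by
    positivity)] at h
  exact h

theorem le_toReal_fourierDeviation (hr : 1 < r) (hq : 0 ≤ q) (hq1 : q < 1) (hp : 1 ≤ p)
    (happrox : ∀ t, |((m + 1 : ℕ) : ℝ) ^ r * tailKernel r β m t -
      poisson q (m + 1) (β * π / 2) t| ≤ ε) {ψ : ℝ → ℝ}
    (hper : Function.Periodic ψ (2 * π)) (hmem : MemLp ψ p periodMeasure)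
    (hnorm : normLp p ψ ≤ 1)
    (hfin : fourierDeviation (m + 1) (weylNagyClass r β p) ≠ ⊤) :
    1 / π * (((m + 1 : ℕ) : ℝ) ^ (-r) *
      ((∫ t, ψ t * poisson q (m + 1) (β * π / 2) t ∂periodMeasure) -
        π * (q * (π / (m + 1 : ℕ)) / (1 - q) ^ 2) - 2 * π * ε)) ≤
      (fourierDeviation (m + 1) (weylNagyClass r β p)).toReal := by
  have h := ofReal_le_fourierDeviation_of_approx hr hp hper hmem hnorm
    (continuous_poisson hq hq1 _) (poisson_periodic _)
    (abs_poisson_half_shift_add_le hq hq1 _) (by positivity) happrox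
  rw [rpow_neg (by positivity)]
  exact (ENNReal.ofReal_le_iff_le_toReal hfin).1 h

end Kernel

/-! ### The asymptotic formulas in terms of q and ε -/

section Asymptotics

variable {r β q ε : ℝ} {m : ℕ} {p p' : ℝ≥0∞}

theorem fourierDeviation_one_asymptotic (hr : 1 < r) (hq : 0 ≤ q) (hq1 : q < 1)
    (happrox : ∀ t, |((m + 1 : ℕ) : ℝ) ^ r * tailKernel r β m t -
      poisson q (m + 1) (β * π / 2) t| ≤ ε) :
    fourierDeviation (m + 1) (weylNagyClass r β 1) ≠ ⊤ ∧
    |(fourierDeviation (m + 1) (weylNagyClass r β 1)).toReal -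
      ((m + 1 : ℕ) : ℝ) ^ (-r) * (1 / (π * (1 - q)))| ≤
      ((m + 1 : ℕ) : ℝ) ^ (-r) * (3 * (q * (π / (m + 1 : ℕ)) / (1 - q) ^ 2) + 2 * ε) := by
  set N := ((m + 1 : ℕ) : ℝ) ^ (-r) with hN
  have hN0 : 0 < N := by positivity
  set δ := q * (π / (m + 1 : ℕ)) / (1 - q) ^ 2 with hδ
  have hδ0 : 0 ≤ δ := by positivity
  have hε0 : 0 ≤ ε := (abs_nonneg _).trans (happrox 0)
  have hq' : 0 < 1 - q := by linarith
  set E := fourierDeviation (m + 1) (weylNagyClass r β 1) with hE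
  have hup : E ≤ ENNReal.ofReal (1 / π * (N * (1 / (1 - q) + 2 * π * ε))) := by
    have h := fourierDeviation_le (p := 1) (p' := ⊤) hr le_rfl
      (normLp_tailKernel_le (p' := ⊤) hr hq hq1 le_top happrox)
    refine h.trans (ENNReal.ofReal_le_ofReal ?_)
    have hP : (normLp ⊤ (poisson q (m + 1) (β * π / 2))).toReal ≤ 1 / (1 - q) := by
      refine ENNReal.toReal_le_of_le_ofReal (by positivity) ?_
      refine (eLpNorm_le_of_ae_bound (ae_of_all _ (abs_poisson_le hq hq1 _))).trans ?_
      simp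
    gcongr
  have hfin : E ≠ ⊤ := (hup.trans_lt ENNReal.ofReal_lt_top).ne
  refine ⟨hfin, ?_⟩
  have hup' : E.toReal ≤ 1 / π * (N * (1 / (1 - q) + 2 * π * ε)) :=
    ENNReal.toReal_le_of_le_ofReal (by positivity) hup
  -- The losses are δ from missing the maximum, πδ from antisymmetrization and 2πε from replacing
  -- the kernel.
  have hlo : 1 / π * (N * (1 / (1 - q) - δ - π * δ - 2 * π * ε)) ≤ E.toReal := by
    obtain ⟨x, hx⟩ := exists_le_poisson (n := m + 1) hq hq1 m.succ_pos (β * π / 2)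
    refine le_of_forall_pos_le_add fun η hη => ?_
    obtain ⟨ψ, hper, hmem, hnorm, hψ⟩ := exists_near_extremal_one
      (continuous_poisson (n := m + 1) hq hq1 (β * π / 2)) (poisson_periodic _) x
      -- Scaled so that the factor N/π turns this loss into η.
      (η := η * π / N) (by positivity)
    have h := le_toReal_fourierDeviation hr hq hq1 le_rfl happrox hper hmem hnorm hfin
    rw [← hE, ← hN, ← hδ] at h
    have h1 : 1 / (1 - q) - δ - π * δ - 2 * π * ε - η * π / N ≤
        (∫ t, ψ t * poisson q (m + 1) (β * π / 2) t ∂periodMeasure) - π * δ - 2 * π * ε := by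
      linarith
    have h2 : 1 / π * (N * (1 / (1 - q) - δ - π * δ - 2 * π * ε - η * π / N)) ≤ E.toReal :=
      le_trans (by gcongr) h
    have h3 : 1 / π * (N * (1 / (1 - q) - δ - π * δ - 2 * π * ε - η * π / N)) =
        1 / π * (N * (1 / (1 - q) - δ - π * δ - 2 * π * ε)) - η := by
      field_simp
    linarith
  have e1 : 1 / π * (N * (1 / (1 - q) + 2 * π * ε)) = N * (1 / (π * (1 - q))) + N * (2 * ε) := by
    field_simp
  have e2 : 1 / π * (N * (1 / (1 - q) - δ - π * δ - 2 * π * ε)) =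
      N * (1 / (π * (1 - q))) - N * ((1 / π + 1) * δ + 2 * ε) := by
    field_simp; ring
  have hpi : 1 / π ≤ 1 := by
    rw [div_le_one pi_pos]; linarith [pi_gt_three]
  have h4 : (1 / π + 1) * δ ≤ 3 * δ := mul_le_mul_of_nonneg_right (by linarith) hδ0
  have h5 : N * ((1 / π + 1) * δ + 2 * ε) ≤ N * (3 * δ + 2 * ε) :=
    mul_le_mul_of_nonneg_left (by linarith) hN0.le
  have h6 : N * (2 * ε) ≤ N * (3 * δ + 2 * ε) := mul_le_mul_of_nonneg_left (by linarith) hN0.le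
  rw [abs_le]
  constructor <;> linarith

theorem fourierDeviation_asymptotic (hr : 1 < r) (hq : 0 ≤ q) (hq1 : q < 1) (hp : 1 < p)
    (hpp : p⁻¹ + p'⁻¹ = 1)
    (happrox : ∀ t, |((m + 1 : ℕ) : ℝ) ^ r * tailKernel r β m t -
      poisson q (m + 1) (β * π / 2) t| ≤ ε) :
    fourierDeviation (m + 1) (weylNagyClass r β p) ≠ ⊤ ∧
    |(fourierDeviation (m + 1) (weylNagyClass r β p)).toReal -
      ((m + 1 : ℕ) : ℝ) ^ (-r) * ((normLp p' cos).toReal / π *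
        (ordinaryHypergeometric (p'.toReal / 2) (p'.toReal / 2) (1 : ℝ) (q ^ 2)) ^
          (1 / p'.toReal))| ≤
      ((m + 1 : ℕ) : ℝ) ^ (-r) * (3 * (q * (π / (m + 1 : ℕ)) / (1 - q) ^ 2) + 2 * ε) := by
  have hconj : ENNReal.HolderConjugate p p' := ENNReal.holderConjugate_iff.2 hpp
  have hp' : 1 ≤ p' := by
    rw [← ENNReal.inv_le_one, ← hpp]
    exact le_add_self
  have hpt' : p' ≠ ⊤ := by
    rintro rfl
    rw [ENNReal.inv_top, add_zero, ENNReal.inv_eq_one] at hpp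
    exact hp.ne' hpp
  set N := ((m + 1 : ℕ) : ℝ) ^ (-r) with hN
  have hN0 : 0 < N := by positivity
  set δ := q * (π / (m + 1 : ℕ)) / (1 - q) ^ 2 with hδ
  have hδ0 : 0 ≤ δ := by positivity
  have hε0 : 0 ≤ ε := (abs_nonneg _).trans (happrox 0)
  set E := fourierDeviation (m + 1) (weylNagyClass r β p) with hE
  set D := (normLp p' (poisson q (m + 1) (β * π / 2))).toReal with hD
  have hD0 : 0 ≤ D := ENNReal.toReal_nonneg
  set G := (ordinaryHypergeometric (p'.toReal / 2) (p'.toReal / 2) (1 : ℝ) (q ^ 2)) ^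
          (1 / p'.toReal) with hG
  have hDA : |D - (normLp p' cos).toReal * G| ≤ 2 * π * δ :=
    abs_normLp_poisson_sub_hypergeometric_le hq hq1 hp' hpt' m.succ_pos _
  have hup : E ≤ ENNReal.ofReal (1 / π * (N * (D + 2 * π * ε))) :=
    fourierDeviation_le hr hp.le (normLp_tailKernel_le hr hq hq1 hp' happrox)
  have hfin : E ≠ ⊤ := (hup.trans_lt ENNReal.ofReal_lt_top).ne
  refine ⟨hfin, ?_⟩
  have hup' : E.toReal ≤ 1 / π * (N * (D + 2 * π * ε)) :=
    ENNReal.toReal_le_of_le_ofReal (by positivity) hup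
  have hlo : 1 / π * (N * (D - π * δ - 2 * π * ε)) ≤ E.toReal := by
    obtain ⟨ψ, hper, hmem, hnorm, hψ⟩ := exists_extremal hp hpp hp' hpt'
      (continuous_poisson (n := m + 1) hq hq1 (β * π / 2)) (poisson_periodic _)
      (memLp_poisson hq hq1 _)
    have h := le_toReal_fourierDeviation hr hq hq1 hp.le happrox hper hmem hnorm hfin
    rwa [hψ] at h
  set A := (normLp p' cos).toReal with hA
  obtain ⟨hD1, hD2⟩ := abs_le.1 hDA
  have h1 : 1 / π * (N * (D + 2 * π * ε)) ≤ 1 / π * (N * (A * G + 2 * π * δ + 2 * π * ε)) := by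
    gcongr; linarith
  -- The 3πδ combines 2πδ from the phase dependence of the norm and πδ from antisymmetrization.
  have h2 : 1 / π * (N * (A * G - 3 * π * δ - 2 * π * ε)) ≤
      1 / π * (N * (D - π * δ - 2 * π * ε)) :=
    mul_le_mul_of_nonneg_left (mul_le_mul_of_nonneg_left (by linarith) hN0.le) (by positivity)
  have e1 : 1 / π * (N * (A * G + 2 * π * δ + 2 * π * ε)) =
      N * (A / π * G) + N * (2 * δ + 2 * ε) := by
    field_simp; ring
  have e2 : 1 / π * (N * (A * G - 3 * π * δ - 2 * π * ε)) =
      N * (A / π * G) - N * (3 * δ + 2 * ε) := by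
    field_simp; ring
  have h3 : N * (2 * δ + 2 * ε) ≤ N * (3 * δ + 2 * ε) :=
    mul_le_mul_of_nonneg_left (by linarith) hN0.le
  rw [abs_le]
  constructor <;> linarith

end Asymptotics

end WeylNagy

/-! ### Choice of q and the final constants -/

theorem theorem2 :
    ∃ C : ℝ, ∀ (n : ℕ) (r β : ℝ), 1 ≤ n → 1 < r → (n : ℝ) + 1 ≤ r → r ≤ (n : ℝ) ^ 2 →
      (WeylNagy.fourierDeviation n (WeylNagy.weylNagyClass r β 1) ≠ ⊤ ∧
        |(WeylNagy.fourierDeviation n (WeylNagy.weylNagyClass r β 1)).toReal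
            - (n : ℝ) ^ (-r) * (1 / (Real.pi * (1 - Real.exp (-r / n))))|
          ≤ C * ((n : ℝ) ^ (-r) * (r / (n : ℝ) ^ 2 * Real.exp (-r / n)))) ∧
      ∀ p p' : ℝ≥0∞, 1 < p → p⁻¹ + p'⁻¹ = 1 →
        WeylNagy.fourierDeviation n (WeylNagy.weylNagyClass r β p) ≠ ⊤ ∧
        |(WeylNagy.fourierDeviation n (WeylNagy.weylNagyClass r β p)).toReal
            - (n : ℝ) ^ (-r) *
              ((WeylNagy.normLp p' Real.cos).toReal / Real.pi *
                (ordinaryHypergeometric (p'.toReal / 2) (p'.toReal / 2) (1 : ℝ)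
                  (Real.exp (-2 * r / n))) ^ (1 / p'.toReal))|
          ≤ C * ((n : ℝ) ^ (-r) * (r / (n : ℝ) ^ 2 * Real.exp (-r / n))) := by
  obtain ⟨C, hC0, hC⟩ := WeylNagy.exists_tsum_coeff_sub_pow_le
  -- The constant is 3 · 4π + 2C: the phase error is at most 4πe and the kernel error at most Ce,
  -- where e = (r/n²)q.
  refine ⟨12 * π + 2 * C, fun n r β hn hr hr1 hr2 => ?_⟩
  obtain ⟨m, rfl⟩ : ∃ m, n = m + 1 := ⟨n - 1, by omega⟩
  have hn0 : (0 : ℝ) < ((m + 1 : ℕ) : ℝ) := by positivity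
  set q := Real.exp (-r / (m + 1 : ℕ)) with hq
  have hq0 : 0 ≤ q := (Real.exp_pos _).le
  -- Since r ≥ n + 1, q ≤ e^(-1); hence 1 - q stays away from zero uniformly.
  have hq2 : q ≤ 1 / 2 := by
    have h1 : -r / ((m + 1 : ℕ) : ℝ) ≤ -1 := by
      rw [div_le_iff₀ hn0]; linarith
    have h2 : Real.exp (-1) ≤ 1 / 2 := by
      rw [Real.exp_neg, ← one_div]
      exact one_div_le_one_div_of_le two_pos (by linarith [Real.add_one_le_exp (1 : ℝ)])
    exact (Real.exp_le_exp.2 h1).trans h2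
  have hq1 : q < 1 := by linarith
  have hqsq : Real.exp (-2 * r / (m + 1 : ℕ)) = q ^ 2 := by
    rw [hq, ← Real.exp_nat_mul]; congr 1; push_cast; ring
  obtain ⟨hsum, hle⟩ := hC (m + 1) r hr1 hr2
  set e := r / ((m + 1 : ℕ) : ℝ) ^ 2 * q with he
  have happrox : ∀ t, |((m + 1 : ℕ) : ℝ) ^ r * WeylNagy.tailKernel r β m t -
      WeylNagy.poisson q (m + 1) (β * π / 2) t| ≤ C * e := fun t =>
    (WeylNagy.abs_tailKernel_sub_poisson_le hr hq0 hq1 hsum t).trans hle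
  -- Here (1 - q)² ≥ 1/4 gives the factor 4, and r ≥ n gives q/n ≤ (r/n²)q.
  have hδ : q * (π / (m + 1 : ℕ)) / (1 - q) ^ 2 ≤ 4 * π * e := by
    have h1 : (1 / 4 : ℝ) ≤ (1 - q) ^ 2 := by nlinarith
    have h2 : q / ((m + 1 : ℕ) : ℝ) ≤ e := by
      have h3 : 1 / ((m + 1 : ℕ) : ℝ) ≤ r / ((m + 1 : ℕ) : ℝ) ^ 2 := by
        rw [div_le_div_iff₀ hn0 (by positivity), sq, one_mul]
        exact mul_le_mul_of_nonneg_right (by linarith) hn0.le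
      calc q / ((m + 1 : ℕ) : ℝ) = 1 / ((m + 1 : ℕ) : ℝ) * q := by ring
        _ ≤ e := mul_le_mul_of_nonneg_right h3 hq0
    have h4 : q * (π / (m + 1 : ℕ)) ≤ π * e := by
      calc q * (π / (m + 1 : ℕ)) = π * (q / ((m + 1 : ℕ) : ℝ)) := by ring
        _ ≤ _ := mul_le_mul_of_nonneg_left h2 pi_pos.le
    rw [div_le_iff₀ (by linarith)]
    have h5 : 0 ≤ π * e := le_trans (by positivity) h4
    nlinarith
  have hfinal : ((m + 1 : ℕ) : ℝ) ^ (-r) *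
      (3 * (q * (π / (m + 1 : ℕ)) / (1 - q) ^ 2) + 2 * (C * e)) ≤
      (12 * π + 2 * C) * (((m + 1 : ℕ) : ℝ) ^ (-r) * e) := by
    calc _ ≤ ((m + 1 : ℕ) : ℝ) ^ (-r) * (3 * (4 * π * e) + 2 * (C * e)) :=
          mul_le_mul_of_nonneg_left (by linarith) (by positivity)
      _ = _ := by ring
  refine ⟨?_, fun p p' hp hpp => ?_⟩
  · obtain ⟨h1, h2⟩ := WeylNagy.fourierDeviation_one_asymptotic hr hq0 hq1 happrox
    exact ⟨h1, h2.trans hfinal⟩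
  · obtain ⟨h1, h2⟩ := WeylNagy.fourierDeviation_asymptotic hr hq0 hq1 hp hpp happrox
    rw [hqsq]
    exact ⟨h1, h2.trans hfinal⟩
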